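/- **Setup.** Let $b_1,\dots,b_r$ generate $N=\mathbb Z^n$, and let $\Sigma$ be a complete simplicial fan in $N_{\mathbb R}$ whose rays are $\mathbb R_{\ge0}b_1,\dots,\mathbb R_{\ge 0}b_{r'}$ ($r'\le r$); these data define a complete toric orbifold $\mathcal X=[\mathbb C^r/\!\!/G]$ (for instance any toric Fano orbifold). Put $\mathbb L=\ker(\mathbb Z^r\to N,\ \tilde b_i\mapsto b_i)\cong\mathbb Z^k$, $k=r-n$, $G=\mathbb L\otimes\mathbb C^*$, choose a $\mathbb Z$-basis $e_1,\dots,e_k$ of $\mathbb L$, and let $l^{(a)}=(l^{(a)}_1,\dots,l^{(a)}_r)\in\mathbb Z^r$ be the image of $e_a$. For $\lambda\in\mathbb C^k$ let $D_i(\lambda)=\sum_a\lambda_a l_i^{(a)}$, and for $x\in\mathbb C^r$ let $$X_i=e^{x_i},\qquad \widetilde H_a(x)=\sum_i l^{(a)}_ix_i,\qquad W=\sum_iX_i,\qquad W_G^{\mathbb C^r}=W-\sum_a\lambda_a\widetilde H_a .$$ Let $\widetilde{\mathcal Y}_t=\{x\in\mathbb C^r:\widetilde H_a(x)=t_a\ \forall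 a\}$, $\Omega=dx_1\cdots dx_r$ and $\Omega_{\widetilde{\mathcal Y}_t}=\Omega/(d\widetilde H_1\wedge\dots\wedge d\widetilde H_k)$. For $c\in\mathbb R^r$ let $F_c=\prod_{i}(\mathbb R+2\pi\sqrt{-1}\,c_i)$. Cycles are oriented so that $\Omega$, respectively $\Omega_{\widetilde{\mathcal Y}_t}$, is positive on them. Let $z>0$ and let $U=\{\gamma\in\mathbb R^k: D_i(\gamma)>0\text{ for all }i\}$. For a function $f$ holomorphic on $U+\sqrt{-1}\,\mathbb R^k$, with $U\subset\mathbb R^k$ open and nonempty, its inverse Fourier transform is $$\mathfrak F_u^{-1}(f)(t)=(2\pi\sqrt{-1})^{-k}\int_{\gamma+\sqrt{-1}\mathbb R^k}f(u)\,e^{-\sum_a u_at_a}\,du_1\cdots du_k,\qquad\gamma\in U,$$ when the integral converges absolutely for every $\gamma \in U$, uniformly (with an integrable majorant) for $\gamma$ in compact subsets of $U$, and does not depend on $\gamma\in U$. **Proposition.** Let $m\in\mathbb Z^r$, and let $c\in\mathbb R^r$ satisfy $|c_i-m_i|<\frac14$ for all $i$ (for example $c=m$, so that $F_{\widetilde{\mathcal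 L}}=F_c$ is the cycle mirror to the line bundle $\widetilde{\mathcal L}=\mathcal O(\sum_i m_i\widetilde{\mathcal D}_i)$ on $\mathbb C^r$, $\widetilde{\mathcal D}_i$ being the $i$-th coordinate hyperplane). 1. For $\lambda\in\mathbb C^k$ the integral $Z_B^{G}(F_c)(\lambda)=\int_{F_c}e^{-W_G^{\mathbb C^r}/z}\,\Omega$ converges absolutely if and only if $\operatorname{Re}D_i(\lambda)>0$ for all $i$, and in that case $$Z_B^{G}(F_c)(\lambda)=\prod_{i=1}^re^{2\pi\sqrt{-1}\,m_iD_i(\lambda)/z}\ \prod_{i=1}^rz^{D_i(\lambda)/z}\,\Gamma\!\left(\tfrac{D_i(\lambda)}z\right)=z^r\prod_{i=1}^re^{2\pi\sqrt{-1}\,m_iD_i(\lambda)/z}\ \prod_{i=1}^rz^{D_i(\lambda)/z}\,\frac{\Gamma\!\left(1+D_i(\lambda)/z\right)}{D_i(\lambda)} .$$ 2. Let $c'\in\mathbb R^r$ satisfy $|c'_i-m_i|<\frac14$ for all $i$, write $F_{\widetilde{\mathcal L}'}=F_{c'}$, and let $t\in\mathbb C^k$ satisfy $\operatorname{Im}t_a=2\pi\sum_il^{(a)}_ic'_i$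 for all $a$. Then $F_{\widetilde{\mathcal L}'}\cap\bigcap_a\{\operatorname{Re}\widetilde H_a=\operatorname{Re}t_a\}$ is a real affine $n$-plane contained in $\widetilde{\mathcal Y}_t$, the integral of $e^{-W/z}\,\Omega_{\widetilde{\mathcal Y}_t}$ over it converges absolutely, $U$ is nonempty and open, $u\mapsto Z_B^G(F_c)(zu)$ is holomorphic on $U+\sqrt{-1}\,\mathbb R^k$, its inverse Fourier transform at $t$ converges in the above sense, and $$\mathfrak F_u^{-1}\bigl(Z_B^{G}(F_c)(zu)\bigr)(t)=\int_{F_{\widetilde{\mathcal L}'}\cap\bigcap_{a=1}^k\{\operatorname{Re}\widetilde H_a=\operatorname{Re}t_a\}}e^{-W/z}\,\Omega_{\widetilde{\mathcal Y}_t}.$$ -/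

import Mathlib

open MeasureTheory Set
open scoped Real

noncomputable section

namespace ToricMirror

/-- The real vector in `N_ℝ = ℝⁿ` of a lattice vector in `N = ℤⁿ`. -/
def toReal {n : ℕ} (v : Fin n → ℤ) : Fin n → ℝ := fun j => (v j : ℝ)

/-- The cone in `N_ℝ = ℝⁿ` spanned by the vectors `b i`, `i ∈ σ`. -/
def cone {n r : ℕ} (b : Fin r → Fin n → ℤ) (σ : Finset (Fin r)) : Set (Fin n → ℝ) :=
  {x | ∃ s : Fin r → ℝ, (∀ i ∈ σ, 0 ≤ s i) ∧ x = ∑ i ∈ σ, s i • toReal (b i)}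

/-- The data of a complete toric orbifold with trivial generic stabilizer: an (extended) stacky
fan in the lattice `N = ℤⁿ`, with `r = n + k` vectors `b_1, …, b_r`. A cone of the simplicial fan
is recorded by the set of indices of its rays; the rays are spanned by the first `r'` vectors and
the remaining vectors are the additional ones, chosen so that `b_1, …, b_r` generate `N`. -/
structure StackyFan (n k : ℕ) where
  /-- The vectors `b_1, …, b_r`. -/
  b : Fin (n + k) → Fin n → ℤ
  /-- The number of rays. -/
  r' : ℕ
  r'_le : r' ≤ n + k
  /-- The cones of the fan, as sets of indices of rays. -/
  cones : Set (Finset (Fin (n + k)))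
  ray_iff : ∀ i, {i} ∈ cones ↔ i.val < r'
  face_mem : ∀ σ ∈ cones, ∀ τ ⊆ σ, τ ∈ cones
  simplicial : ∀ σ ∈ cones, LinearIndependent ℝ (fun i : σ => toReal (b i))
  inter_eq : ∀ σ ∈ cones, ∀ τ ∈ cones, cone b σ ∩ cone b τ = cone b (σ ∩ τ)
  complete : ∀ x : Fin n → ℝ, ∃ σ ∈ cones, x ∈ cone b σ
  generate : Submodule.span ℤ (range b) = ⊤

/-- `𝕃 = Ker (φ : ℤʳ → N)`, where `φ` sends the `i`-th basis vector to `b_i`. -/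
def StackyFan.L {n k : ℕ} (S : StackyFan n k) : Submodule ℤ (Fin (n + k) → ℤ) :=
  LinearMap.ker (Fintype.linearCombination ℤ S.b)

variable {n k : ℕ} {S : StackyFan n k}

/-- The charge vectors `l⁽ᵃ⁾ ∈ ℤʳ`: the images in `ℤʳ` of the basis `e_a` of `𝕃`. With
`p_a` the dual basis of `𝕃^∨`, one has `D_i = ∑ₐ l_i⁽ᵃ⁾ p_a`. -/
def charge (e : Module.Basis (Fin k) ℤ S.L) (a : Fin k) (i : Fin (n + k)) : ℤ :=
  (e a : Fin (n + k) → ℤ) i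

/-- `D_i(u) = ∑ₐ u_a l_i⁽ᵃ⁾` for `u ∈ 𝕃_ℂ = ℂᵏ`. -/
def divisor (e : Module.Basis (Fin k) ℤ S.L) (i : Fin (n + k)) (u : Fin k → ℂ) : ℂ :=
  ∑ a, u a * (charge e a i : ℂ)

/-- `H̃_a(x) = ∑ᵢ l_i⁽ᵃ⁾ x_i` on `M̃_ℂ = ℂʳ`. -/
def Htilde (e : Module.Basis (Fin k) ℤ S.L) (a : Fin k) (x : Fin (n + k) → ℂ) : ℂ :=
  ∑ i, (charge e a i : ℂ) * x i

/-- The superpotential `W = X_1 + ⋯ + X_r` in the coordinates `X_i = exp x_i`. -/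
def W {r : ℕ} (x : Fin r → ℂ) : ℂ := ∑ i, Complex.exp (x i)

/-- The `G`-equivariant superpotential `X_1 + ⋯ + X_r - ∑ₐ λ_a ∑ᵢ l_i⁽ᵃ⁾ x_i` on `M̃_ℂ`. -/
def WG (e : Module.Basis (Fin k) ℤ S.L) (lam : Fin k → ℂ) (x : Fin (n + k) → ℂ) : ℂ :=
  W x - ∑ a, lam a * Htilde e a x

/-- The mirror cycle `∏ᵢ (ℝ + 2π√-1 c_i)` in `M̃_ℂ = ℂʳ`. -/
def mirrorCycle {r : ℕ} (c : Fin r → ℝ) : Set (Fin r → ℂ) :=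
  {x | ∀ i, (x i).im = 2 * π * c i}

/-- The tautological parametrization `y ↦ y + 2π√-1 c` of `mirrorCycle c` by `ℝʳ`, which carries
`Ω = dx_1 ⋯ dx_r` to Lebesgue measure. -/
def cyclePoint {r : ℕ} (c : Fin r → ℝ) (y : Fin r → ℝ) : Fin r → ℂ :=
  fun i => (y i : ℂ) + 2 * π * c i * Complex.I

/-- The integrand `exp (-W_G / z)` on the mirror cycle. -/
def equivIntegrand (e : Module.Basis (Fin k) ℤ S.L) (z : ℝ) (c : Fin (n + k) → ℝ)
    (lam : Fin k → ℂ) (y : Fin (n + k) → ℝ) : ℂ :=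
  Complex.exp (-(WG e lam (cyclePoint c y)) / z)

/-- The `G`-equivariant B-model central charge `∫_{F} exp (-W_G / z) Ω` of the cycle
`F = mirrorCycle c`. -/
def equivCentralCharge (e : Module.Basis (Fin k) ℤ S.L) (z : ℝ) (c : Fin (n + k) → ℝ)
    (lam : Fin k → ℂ) : ℂ :=
  ∫ y : Fin (n + k) → ℝ, equivIntegrand e z c lam y

/-- The mirror fibre `Ỹ_t = {x ∈ ℂʳ | H̃_a(x) = t_a for all a}`. -/
def mirrorFibre (e : Module.Basis (Fin k) ℤ S.L) (t : Fin k → ℂ) : Set (Fin (n + k) → ℂ) :=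
  {x | ∀ a, Htilde e a x = t a}

/-- The cycle `F ∩ ⋂ₐ {Re H̃_a = Re t_a}` for `F = mirrorCycle c`. -/
def slice (e : Module.Basis (Fin k) ℤ S.L) (c : Fin (n + k) → ℝ) (t : Fin k → ℂ) :
    Set (Fin (n + k) → ℂ) :=
  mirrorCycle c ∩ ⋂ a, {x | (Htilde e a x).re = (t a).re}

/-- An affine parametrization `s ↦ origin + ∑ⱼ s_j dir_j` by `ℝⁿ` of a real `n`-plane `F ⊆ ℂʳ` with
real directions, with a frame of real vectors `normal_1, …, normal_k`
on which `dH̃_a (normal_b) = δ_{ab}` (used to evaluate the quotient form `Ω / (dH̃_1 ∧ ⋯ ∧ dH̃_k)`). -/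
structure Chart (e : Module.Basis (Fin k) ℤ S.L) (F : Set (Fin (n + k) → ℂ)) where
  origin : Fin (n + k) → ℂ
  dir : Fin n → Fin (n + k) → ℝ
  normal : Fin k → Fin (n + k) → ℝ
  dir_indep : LinearIndependent ℝ dir
  range_eq : range (fun (s : Fin n → ℝ) (i : Fin (n + k)) =>
    origin i + ((∑ j, s j * dir j i : ℝ) : ℂ)) = F
  normal_dual : ∀ a b, ∑ i, (charge e a i : ℝ) * normal b i = if a = b then 1 else 0

namespace Chart

variable {e : Module.Basis (Fin k) ℤ S.L} {F : Set (Fin (n + k) → ℂ)}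

/-- The point of the plane with parameter `s`. -/
def point (χ : Chart e F) (s : Fin n → ℝ) : Fin (n + k) → ℂ :=
  fun i => χ.origin i + ((∑ j, s j * χ.dir j i : ℝ) : ℂ)

/-- The density of `Ω_{Ỹ_t} = dx_1 ⋯ dx_r / (dH̃_1 ∧ ⋯ ∧ dH̃_k)` in the parameters `s`, for the
orientation of the plane in which it is positive. Since `Ω = Ω_{Ỹ_t} ∧ dH̃_1 ∧ ⋯ ∧ dH̃_k`,
`dH̃_a (dir_j) = 0` and `dH̃_a (normal_b) = δ_{ab}`, one has
`Ω_{Ỹ_t} (dir) = Ω (dir, normal) = det (dir, normal)`. -/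
def density (χ : Chart e F) : ℝ :=
  |Matrix.det (Matrix.of (Fin.append χ.dir χ.normal))|

/-- The pull-back of `exp (-W / z) Ω_{Ỹ_t}` to the parameters `s`. -/
def integrand (χ : Chart e F) (z : ℝ) (s : Fin n → ℝ) : ℂ :=
  Complex.exp (-(W (χ.point s)) / z) * (χ.density : ℂ)

/-- The non-equivariant B-model central charge `∫_F exp (-W / z) Ω_{Ỹ_t}`, computed in the
given parametrization of `F`. -/
def centralCharge (χ : Chart e F) (z : ℝ) : ℂ :=
  ∫ s : Fin n → ℝ, χ.integrand z s

end Chart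

/-- The point `γ + √-1 ν` of the tube `ℝᵏ + √-1 ℝᵏ`. -/
def tubePoint {k : ℕ} (γ ν : Fin k → ℝ) : Fin k → ℂ := fun a => (γ a : ℂ) + ν a * Complex.I

/-- The integrand `f(u) exp (-∑ₐ u_a t_a)` of the inverse Fourier transform at `u = γ + √-1 ν`. -/
def fourierIntegrand {k : ℕ} (f : (Fin k → ℂ) → ℂ) (t : Fin k → ℂ) (γ ν : Fin k → ℝ) : ℂ :=
  f (tubePoint γ ν) * Complex.exp (-∑ a, tubePoint γ ν a * t a)

/-- `HasInverseFourier U f t v`: the function `f` is holomorphic on the tube `U + √-1 ℝᵏ` over the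
nonempty open set `U ⊆ ℝᵏ`, and its inverse Fourier transform
`(2π√-1)⁻ᵏ ∫_{γ + √-1 ℝᵏ} f(u) exp (-∑ₐ u_a t_a) du_1 ⋯ du_k`
at `t` converges absolutely for every `γ ∈ U`, uniformly for `γ` in compact subsets of `U` (in the
sense of an integrable majorant), and has the value `v` for every `γ ∈ U`. On the
contour `du_a = √-1 dν_a`, so that `(2π√-1)⁻ᵏ du_1 ⋯ du_k = (2π)⁻ᵏ dν_1 ⋯ dν_k`. -/
structure HasInverseFourier {k : ℕ} (U : Set (Fin k → ℝ)) (f : (Fin k → ℂ) → ℂ)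
    (t : Fin k → ℂ) (v : ℂ) : Prop where
  isOpen : IsOpen U
  nonempty : U.Nonempty
  holomorphic : DifferentiableOn ℂ f {u | (fun a => (u a).re) ∈ U}
  integrable : ∀ γ ∈ U, Integrable (fourierIntegrand f t γ)
  uniform : ∀ K ⊆ U, IsCompact K → ∃ g : (Fin k → ℝ) → ℝ, Integrable g ∧
    ∀ γ ∈ K, ∀ ν, ‖fourierIntegrand f t γ ν‖ ≤ g ν
  value : ∀ γ ∈ U, ((2 * π : ℂ) ^ k)⁻¹ * ∫ ν, fourierIntegrand f t γ ν = v

/-- The cone `{γ ∈ 𝕃_ℝ = ℝᵏ | D_i(γ) > 0 for all i}`. -/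
def positiveCone (e : Module.Basis (Fin k) ℤ S.L) : Set (Fin k → ℝ) :=
  {γ | ∀ i, 0 < ∑ a, γ a * (charge e a i : ℝ)}

end ToricMirror

end

/-! Interchanging sums gives `∑ λ_a H̃_a = ∑ D_i(λ) x_i`, so the equivariant integrand is a product
of one-variable kernels `exp(-e^x / z + s x)` with `s = D_i(λ) / z`, on the line of height `2π c_i`.
Since `|c_i - m_i| < 1/4`, the cosine of this height is positive: the double exponential controls
`+∞`, and convergence at `-∞` is exactly `Re s > 0`. Periodicity of `e^x` removes `2π m_i` at the
cost of `exp(2π√-1 m_i s)`; the remaining height lies within `π/2` of zero and is removed by a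
contour shift, leaving Euler's integral (`integral_gammaKernel_eq`).

For the Fourier statement, take real affine coordinates `(s, h)` on `F_{c'}` with `s` along the
slice and `H̃_a = t_a + h_a`. Let `φ(h)` be the integral of `exp(-W / z)`, with the quotient
density, over the translate of the slice by `h`. Fubini gives `Z(zu) exp(-u·t) = ∫ exp(u·h) φ(h) dh`
(`fourierIntegrand_eq_integral`). For `u = γ + √-1 ν` this is the Fourier transform of `exp(γ·h)
φ(h)`, and inversion at `h = 0` returns `φ(0)`, the required fibre integral.

Two estimates justify inversion. On vertical lines Gamma decays like `exp(-β|τ|)` for every `β <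
π/2`, which beats the growth `exp(2π|c'_i - m_i||τ|)` of the other factors
(`exists_norm_fourierIntegrand_le`). Completeness of the fan gives a strictly positive relation
among the `b_i`, hence a point of the positive cone; the linear function it defines is constant on
each slice, and inserting it in the exponent forces decay in every direction
(`exists_norm_fibreIntegrand_le`). -/

noncomputable section

namespace ToricMirror

/-! ### The one-dimensional oscillating integral -/

/-- The one-dimensional factor `exp (-e^x / z + s x)` at `x = y + √-1 θ`. -/
def gammaKernel (z θ : ℝ) (s : ℂ) (y : ℝ) : ℂ :=
  Complex.exp (-Complex.exp (y + θ * Complex.I) / z + s * (y + θ * Complex.I))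

lemma norm_gammaKernel (z θ : ℝ) (s : ℂ) (y : ℝ) :
    ‖gammaKernel z θ s y‖ =
      Real.exp (-(Real.cos θ / z) * Real.exp y + s.re * y - s.im * θ) := by
  rw [gammaKernel, Complex.norm_exp]
  congr 1
  rw [Complex.add_re, neg_div, Complex.neg_re, Complex.div_ofReal_re, Complex.exp_re]
  simp
  ring

lemma continuous_gammaKernel (z θ : ℝ) (s : ℂ) : Continuous (gammaKernel z θ s) := by
  unfold gammaKernel
  fun_prop

lemma exp_neg_mul_exp_add_le {a α : ℝ} (ha : 0 < a) (hα : 0 < α) (y : ℝ) :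
    Real.exp (-a * Real.exp y + α * y) ≤ Real.exp (2 * α ^ 2 / a) * Real.exp (-α * |y|) := by
  rw [← Real.exp_add, Real.exp_le_exp]
  have hC : 0 ≤ 2 * α ^ 2 / a := by positivity
  rcases le_total y 0 with hy | hy
  · rw [abs_of_nonpos hy]
    nlinarith [Real.exp_pos y]
  · rw [abs_of_nonneg hy]
    have h1 : y ^ 2 / 2 ≤ Real.exp y := by
      have := Real.quadratic_le_exp_of_nonneg hy
      linarith
    -- One `α y` comes from the exponent and one from the desired decay; the quadratic peaks at `y =
    -- 2α / a` with value `2α² / a`.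
    have h2 : 2 * α * y - a * (y ^ 2 / 2) ≤ 2 * α ^ 2 / a := by
      rw [le_div_iff₀ ha]
      nlinarith [sq_nonneg (a * y - 2 * α)]
    nlinarith [mul_le_mul_of_nonneg_left h1 ha.le]

lemma integrable_exp_neg_mul_abs {ε : ℝ} (hε : 0 < ε) :
    Integrable (fun y : ℝ => Real.exp (-ε * |y|)) := by
  have hpos : IntegrableOn (fun y : ℝ => Real.exp (-ε * |y|)) (Ioi 0) :=
    (integrableOn_exp_mul_Ioi (a := -ε) (by linarith) 0).congr_fun
      (fun y hy => by simp only [abs_of_pos (mem_Ioi.1 hy)]) measurableSet_Ioi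
  have hneg : IntegrableOn (fun y : ℝ => Real.exp (-ε * |y|)) (Iic 0) :=
    (integrableOn_exp_mul_Iic hε 0).congr_fun
      (fun y hy => by simp only [abs_of_nonpos (mem_Iic.1 hy), neg_mul_neg]) measurableSet_Iic
  rw [← integrableOn_univ, ← Iic_union_Ioi (a := (0 : ℝ))]
  exact hneg.union hpos

lemma integrable_gammaKernel {z θ : ℝ} (hz : 0 < z) (hθ : 0 < Real.cos θ) {s : ℂ}
    (hs : 0 < s.re) : Integrable (gammaKernel z θ s) := by
  refine Integrable.mono' (((integrable_exp_neg_mul_abs hs).const_mul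
    (Real.exp (2 * s.re ^ 2 / (Real.cos θ / z)))).mul_const (Real.exp (-s.im * θ)))
    (continuous_gammaKernel z θ s).aestronglyMeasurable (.of_forall fun y => ?_)
  rw [norm_gammaKernel, sub_eq_add_neg, Real.exp_add, ← neg_mul]
  gcongr
  exact exp_neg_mul_exp_add_le (by positivity) hs y

lemma gammaKernel_add_one (z θ : ℝ) (s : ℂ) (y : ℝ) :
    gammaKernel z θ (s + 1) y = Complex.exp (y + θ * Complex.I) * gammaKernel z θ s y := by
  rw [gammaKernel, gammaKernel, ← Complex.exp_add]
  congr 1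
  ring

lemma hasDerivAt_gammaKernel (z θ : ℝ) (s : ℂ) (y : ℝ) :
    HasDerivAt (gammaKernel z θ s)
      (s * gammaKernel z θ s y - (z : ℂ)⁻¹ * gammaKernel z θ (s + 1) y) y := by
  have h0 : HasDerivAt (fun y : ℝ => (y : ℂ) + θ * Complex.I) 1 y :=
    Complex.ofRealCLM.hasDerivAt.add_const _
  have h1 := ((h0.cexp.neg.div_const (z : ℂ)).add (h0.const_mul s)).cexp
  convert! h1 using 1
  rw [gammaKernel_add_one, gammaKernel]
  simp only [Pi.add_apply, Pi.neg_apply]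
  ring

/-- The kernel is holomorphic in `x = y + √-1 θ`, so its derivative in `θ` is `√-1` times its
derivative in `y`. -/
lemma hasDerivAt_gammaKernel_angle (z θ : ℝ) (s : ℂ) (y : ℝ) :
    HasDerivAt (fun θ => gammaKernel z θ s y)
      (Complex.I * (s * gammaKernel z θ s y - (z : ℂ)⁻¹ * gammaKernel z θ (s + 1) y)) θ := by
  have h0 : HasDerivAt (fun θ : ℝ => (y : ℂ) + θ * Complex.I) Complex.I θ := by
    simpa using (Complex.ofRealCLM.hasDerivAt.mul_const Complex.I).const_add (y : ℂ)
  have h1 := ((h0.cexp.neg.div_const (z : ℂ)).add (h0.const_mul s)).cexp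
  convert! h1 using 1
  rw [gammaKernel_add_one, gammaKernel]
  simp only [Pi.add_apply, Pi.neg_apply]
  ring

lemma norm_gammaKernel_le {z θ κ ω : ℝ} (hz : 0 < z) (hκ : κ ≤ Real.cos θ) (hω : |θ| ≤ ω)
    (s : ℂ) (y : ℝ) :
    ‖gammaKernel z θ s y‖ ≤
      Real.exp (-(κ / z) * Real.exp y + s.re * y) * Real.exp (|s.im| * ω) := by
  rw [norm_gammaKernel, ← Real.exp_add, Real.exp_le_exp]
  have h1 : κ / z ≤ Real.cos θ / z := by gcongr
  have h2 : -(s.im * θ) ≤ |s.im| * ω :=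
    (neg_le_abs _).trans (by rw [abs_mul]; gcongr)
  nlinarith [mul_le_mul_of_nonneg_right h1 (Real.exp_pos y).le]

lemma integrable_exp_neg_mul_exp_add {a α : ℝ} (ha : 0 < a) (hα : 0 < α) :
    Integrable (fun y : ℝ => Real.exp (-a * Real.exp y + α * y)) :=
  ((integrable_exp_neg_mul_abs hα).const_mul (Real.exp (2 * α ^ 2 / a))).mono'
    (by fun_prop) (.of_forall fun y => by
      rw [Real.norm_of_nonneg (Real.exp_pos _).le]
      exact exp_neg_mul_exp_add_le ha hα y)

/-- Infinitesimal contour shift: under the integral sign the angular derivative is a total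
derivative in `y` of an integrable function, so it integrates to zero. -/
lemma hasDerivAt_integral_gammaKernel {z θ : ℝ} (hz : 0 < z) (hθ : |θ| < π / 2) {s : ℂ}
    (hs : 0 < s.re) : HasDerivAt (fun θ => ∫ y, gammaKernel z θ s y) 0 θ := by
  -- On `|t| < ω` the cosine stays above `cos ω > 0`, which yields a single dominating function.
  obtain ⟨ω, hω, hω'⟩ := exists_between hθ
  have hω0 : 0 < ω := (abs_nonneg θ).trans_lt hω
  have hκ : 0 < Real.cos ω := Real.cos_pos_of_mem_Ioo ⟨by linarith, hω'⟩
  have hcos : ∀ t : ℝ, |t| < ω → Real.cos ω ≤ Real.cos t := fun t ht => by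
    rw [← Real.cos_abs t]
    exact Real.cos_le_cos_of_nonneg_of_le_pi (abs_nonneg t) (by linarith [Real.pi_pos]) ht.le
  have hs1 : 0 < (s + 1).re := by simp; linarith
  have hθcos : 0 < Real.cos θ := hκ.trans_le (hcos θ hω)
  have hnhds : {t : ℝ | |t| < ω} ∈ nhds θ := (isOpen_lt continuous_abs continuous_const).mem_nhds hω
  have hint (w : ℂ) (hw : 0 < w.re) : Integrable (fun y : ℝ =>
      Real.exp (-(Real.cos ω / z) * Real.exp y + w.re * y) * Real.exp (|w.im| * ω)) :=
    (integrable_exp_neg_mul_exp_add (by positivity) hw).mul_const _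
  have key := (hasDerivAt_integral_of_dominated_loc_of_deriv_le (μ := volume)
    (F := fun θ y => gammaKernel z θ s y)
    (F' := fun θ y =>
      Complex.I * (s * gammaKernel z θ s y - (z : ℂ)⁻¹ * gammaKernel z θ (s + 1) y))
    hnhds (.of_forall fun t => (continuous_gammaKernel z t s).aestronglyMeasurable)
    (integrable_gammaKernel hz hθcos hs)
    (Continuous.aestronglyMeasurable (by
      have := continuous_gammaKernel z θ s
      have := continuous_gammaKernel z θ (s + 1)
      fun_prop))
    (.of_forall fun y t ht => ?_) (((hint s hs).const_mul ‖s‖).add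
      ((hint (s + 1) hs1).const_mul ‖(z : ℂ)⁻¹‖))
    (.of_forall fun y t _ => hasDerivAt_gammaKernel_angle z t s y)).2
  · rwa [integral_const_mul, integral_eq_zero_of_hasDerivAt_of_integrable
      (f := gammaKernel z θ s) (fun y => hasDerivAt_gammaKernel z θ s y), mul_zero] at key
    · exact ((integrable_gammaKernel hz hθcos hs).const_mul s).sub
        ((integrable_gammaKernel hz hθcos hs1).const_mul _)
    · exact integrable_gammaKernel hz hθcos hs
  · rw [norm_mul, Complex.norm_I, one_mul]
    refine (norm_sub_le _ _).trans ?_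
    rw [norm_mul, norm_mul]
    have h1 := norm_gammaKernel_le hz (hcos t ht) (le_of_lt ht) s y
    have h2 := norm_gammaKernel_le hz (hcos t ht) (le_of_lt ht) (s + 1) y
    exact add_le_add (mul_le_mul_of_nonneg_left h1 (norm_nonneg _))
      (mul_le_mul_of_nonneg_left h2 (norm_nonneg _))

lemma integral_gammaKernel_zero {z : ℝ} (hz : 0 < z) {s : ℂ} (hs : 0 < s.re) :
    ∫ y, gammaKernel z 0 s y = (z : ℂ) ^ s * Complex.Gamma s := by
  have key := Complex.integral_cpow_mul_exp_neg_mul_Ioi hs (inv_pos.2 hz)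
  -- The substitution `x = e^y` turns Euler's integral over the half-line into the kernel at angle
  -- zero.
  have himg : Real.exp '' univ = Ioi 0 := by rw [image_univ, Real.range_exp]
  rw [← himg, integral_image_eq_integral_abs_deriv_smul MeasurableSet.univ
    (fun x _ => (Real.hasDerivAt_exp x).hasDerivWithinAt) Real.exp_injective.injOn,
    setIntegral_univ, Complex.ofReal_inv, one_div, inv_inv] at key
  rw [← key]
  congr 1 with y
  rw [abs_of_pos (Real.exp_pos y), Complex.real_smul,
    Complex.cpow_def_of_ne_zero (Complex.ofReal_ne_zero.2 (Real.exp_ne_zero _)),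
    ← Complex.ofReal_log (Real.exp_pos y).le, Real.log_exp, Complex.ofReal_exp,
    ← Complex.exp_add, ← Complex.exp_add, gammaKernel]
  congr 1
  simp
  ring

lemma integral_gammaKernel_eq {z θ φ : ℝ} (hz : 0 < z) {m : ℤ} (hφ : θ = φ + 2 * π * m)
    (h : |φ| < π / 2) {s : ℂ} (hs : 0 < s.re) :
    ∫ y, gammaKernel z θ s y =
      Complex.exp (2 * π * Complex.I * m * s) * ((z : ℂ) ^ s * Complex.Gamma s) := by
  have hexp : Complex.exp (θ * Complex.I) = Complex.exp (φ * Complex.I) := by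
    rw [hφ, Complex.exp_eq_exp_iff_exists_int]
    exact ⟨m, by push_cast; ring⟩
  have hpt : ∀ y : ℝ, gammaKernel z θ s y =
      Complex.exp (2 * π * Complex.I * m * s) * gammaKernel z φ s y := by
    intro y
    rw [gammaKernel, gammaKernel, Complex.exp_add _ (θ * _), hexp, ← Complex.exp_add,
      ← Complex.exp_add, hφ]
    congr 1
    push_cast
    ring
  simp_rw [hpt]
  rw [integral_const_mul, ← integral_gammaKernel_zero hz hs]
  congr 1
  have hopen : IsOpen {t : ℝ | |t| < π / 2} := isOpen_lt continuous_abs continuous_const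
  have hconn : IsPreconnected {t : ℝ | |t| < π / 2} := by
    have : {t : ℝ | |t| < π / 2} = Ioo (-(π / 2)) (π / 2) := by ext; simp [abs_lt]
    rw [this]
    exact isPreconnected_Ioo
  exact hopen.is_const_of_deriv_eq_zero hconn
    (fun t ht => (hasDerivAt_integral_gammaKernel hz ht hs).differentiableAt.differentiableWithinAt)
    (fun t ht => (hasDerivAt_integral_gammaKernel hz ht hs).deriv) h (by simpa using Real.pi_pos)

/-- Write Gamma as the integral at angle `β` and take norms inside. The norm of the kernel is
`exp(-βτ)` times the kernel at angle zero with real exponent `σ` and `z = (cos β)⁻¹`, which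
integrates to a Gamma value again. -/
lemma norm_Gamma_le_mul_exp {σ τ β : ℝ} (hσ : 0 < σ) (hβ : |β| < π / 2) :
    ‖Complex.Gamma (σ + τ * Complex.I)‖ ≤
      Real.exp (-(β * τ)) * (Real.Gamma σ * (Real.cos β)⁻¹ ^ σ) := by
  have hcos : 0 < Real.cos β := Real.cos_pos_of_mem_Ioo (abs_lt.1 hβ)
  have h := integral_gammaKernel_eq (z := 1) (θ := β) (φ := β) (m := 0) one_pos (by simp) hβ
    (s := σ + τ * Complex.I) (by simpa using hσ)
  have h0 := integral_gammaKernel_eq (z := (Real.cos β)⁻¹) (θ := 0) (φ := 0) (m := 0)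
    (by positivity) (by simp) (by simpa using Real.pi_pos) (s := σ) (by simpa using hσ)
  simp only [Int.cast_zero, mul_zero, zero_mul, Complex.exp_zero, one_mul, Complex.ofReal_one,
    Complex.one_cpow] at h h0
  rw [← h]
  refine (norm_integral_le_integral_norm _).trans (le_of_eq ?_)
  rw [mul_comm (Real.Gamma σ)]
  apply Complex.ofReal_injective
  rw [← integral_complex_ofReal, Complex.ofReal_mul, Complex.ofReal_mul,
    Complex.ofReal_cpow (by positivity), ← Complex.Gamma_ofReal, ← h0, ← integral_const_mul]
  congr 1 with y
  rw [norm_gammaKernel, gammaKernel, Complex.ofReal_exp, Complex.ofReal_exp, ← Complex.exp_add]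
  congr 1
  simp
  ring

lemma norm_Gamma_le_exp_abs {σ τ β : ℝ} (hσ : 0 < σ) (hβ0 : 0 ≤ β) (hβ : β < π / 2) :
    ‖Complex.Gamma (σ + τ * Complex.I)‖ ≤
      Real.exp (-(β * |τ|)) * (Real.Gamma σ * (Real.cos β)⁻¹ ^ σ) := by
  rcases le_total 0 τ with h | h
  · rw [abs_of_nonneg h]
    exact norm_Gamma_le_mul_exp hσ (by rwa [abs_of_nonneg hβ0])
  · have := norm_Gamma_le_mul_exp (τ := τ) (β := -β) hσ (by rwa [abs_neg, abs_of_nonneg hβ0])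
    rw [abs_of_nonpos h]
    rwa [Real.cos_neg, neg_mul, ← mul_neg] at this

variable {n k : ℕ} {S : StackyFan n k}

/-! ### The equivariant central charge -/

lemma sum_mul_Htilde (e : Module.Basis (Fin k) ℤ S.L) (u : Fin k → ℂ) (x : Fin (n + k) → ℂ) :
    ∑ a, u a * Htilde e a x = ∑ i, divisor e i u * x i := by
  simp only [Htilde, divisor, Finset.mul_sum, Finset.sum_mul]
  rw [Finset.sum_comm]
  exact Finset.sum_congr rfl fun i _ => Finset.sum_congr rfl fun a _ => by ring

lemma equivIntegrand_eq_prod (e : Module.Basis (Fin k) ℤ S.L) (z : ℝ) (c : Fin (n + k) → ℝ)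
    (lam : Fin k → ℂ) (y : Fin (n + k) → ℝ) :
    equivIntegrand e z c lam y =
      ∏ i, gammaKernel z (2 * π * c i) (divisor e i lam / z) (y i) := by
  simp only [equivIntegrand, gammaKernel]
  rw [← Complex.exp_sum]
  congr 1
  rw [WG, sum_mul_Htilde, W, ← Finset.sum_sub_distrib, neg_div, Finset.sum_div,
    ← Finset.sum_neg_distrib]
  refine Finset.sum_congr rfl fun i _ => ?_
  simp only [cyclePoint]
  push_cast
  ring

lemma divisor_smul (e : Module.Basis (Fin k) ℤ S.L) (i : Fin (n + k)) (z : ℂ) (u : Fin k → ℂ) :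
    divisor e i (fun a => z * u a) = z * divisor e i u := by
  simp only [divisor, Finset.mul_sum, mul_assoc]

lemma abs_angle_sub_lt {c : ℝ} {m : ℤ} (hc : |c - m| < 1 / 4) :
    |2 * π * (c - m)| < π / 2 := by
  rw [abs_mul, abs_of_pos (by positivity)]
  nlinarith [Real.pi_pos]

lemma cos_angle_pos {c : ℝ} {m : ℤ} (hc : |c - m| < 1 / 4) : 0 < Real.cos (2 * π * c) := by
  have h := Real.cos_pos_of_mem_Ioo (abs_lt.1 (abs_angle_sub_lt hc))
  rwa [show 2 * π * (c - m) = 2 * π * c - m * (2 * π) by ring,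
    Real.cos_sub_int_mul_two_pi] at h

lemma volume_pi_ite_Iic_Icc {ι : Type*} [Fintype ι] [DecidableEq ι] (j : ι) :
    volume (Set.pi univ fun i : ι => if i = j then Iic (0 : ℝ) else Icc (0 : ℝ) 1) = ⊤ := by
  rw [volume_pi_pi, ← Finset.mul_prod_erase _ _ (Finset.mem_univ j), if_pos rfl, Real.volume_Iic,
    Finset.prod_congr rfl (g := fun _ => (1 : ENNReal))
      (fun i hi => by rw [if_neg (Finset.ne_of_mem_erase hi), Real.volume_Icc]; simp)]
  simp

/-- If some `Re s_j ≤ 0`, the norm is bounded below on a half-line in direction `j` times unit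
intervals, a set of infinite volume. This tests the product directly, without separating the
factors. -/
lemma integrable_prod_gammaKernel_iff {ι : Type*} [Fintype ι] {z : ℝ} (hz : 0 < z) {θ : ι → ℝ}
    (hθ : ∀ i, 0 < Real.cos (θ i)) (s : ι → ℂ) :
    Integrable (fun y : ι → ℝ => ∏ i, gammaKernel z (θ i) (s i) (y i)) ↔ ∀ i, 0 < (s i).re := by
  classical
  refine ⟨fun h => ?_, fun h => Integrable.fintype_prod (μ := fun _ => volume) fun i =>
    integrable_gammaKernel hz (hθ i) (h i)⟩
  by_contra! hj
  obtain ⟨j, hj⟩ := hj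
  -- A lower bound for the exponent of each factor, using only `y_i ≤ 1` and `Re s_i · y_i ≥ -|Re
  -- s_i|`.
  set b : ι → ℝ := fun i => -(Real.cos (θ i) / z) * Real.exp 1 - |(s i).re| - |(s i).im * θ i|
  have hlow : ∀ y ∈ Set.pi univ fun i : ι => if i = j then Iic (0 : ℝ) else Icc (0 : ℝ) 1,
      Real.exp (∑ i, b i) ≤ ‖∏ i, gammaKernel z (θ i) (s i) (y i)‖ := by
    intro y hy
    rw [norm_prod, Real.exp_sum]
    refine Finset.prod_le_prod (fun _ _ => (Real.exp_pos _).le) fun i _ => ?_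
    rw [norm_gammaKernel, Real.exp_le_exp]
    have hyi : y i ∈ if i = j then Iic (0 : ℝ) else Icc (0 : ℝ) 1 := hy i (mem_univ i)
    have hc : 0 < Real.cos (θ i) / z := div_pos (hθ i) hz
    have hy1 : y i ≤ 1 ∧ -|(s i).re| ≤ (s i).re * y i := by
      by_cases hij : i = j
      · rw [if_pos hij, mem_Iic] at hyi
        rw [hij] at hyi ⊢
        exact ⟨by linarith, (neg_nonpos.2 (abs_nonneg _)).trans
          (mul_nonneg_of_nonpos_of_nonpos hj hyi)⟩
      · rw [if_neg hij, mem_Icc] at hyi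
        refine ⟨hyi.2, ?_⟩
        nlinarith [neg_abs_le (s i).re, abs_nonneg (s i).re]
    have he : Real.exp (y i) ≤ Real.exp 1 := Real.exp_le_exp.2 hy1.1
    have := le_abs_self ((s i).im * θ i)
    have := mul_le_mul_of_nonneg_left he hc.le
    simp only [b]
    linarith [hy1.2]
  have hfin := h.measure_norm_ge_lt_top (Real.exp_pos (∑ i, b i))
  have := (measure_mono hlow).trans_lt hfin
  rw [volume_pi_ite_Iic_Icc j] at this
  exact lt_irrefl _ this

lemma divisor_div_re_pos_iff {e : Module.Basis (Fin k) ℤ S.L} {z : ℝ} (hz : 0 < z)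
    {i : Fin (n + k)} {lam : Fin k → ℂ} :
    0 < (divisor e i lam / z).re ↔ 0 < (divisor e i lam).re := by
  rw [Complex.div_ofReal_re, div_pos_iff_of_pos_right hz]

lemma integrable_equivIntegrand_iff (e : Module.Basis (Fin k) ℤ S.L) {z : ℝ} (hz : 0 < z)
    {c : Fin (n + k) → ℝ} {m : Fin (n + k) → ℤ} (hc : ∀ i, |c i - m i| < 1 / 4)
    (lam : Fin k → ℂ) :
    Integrable (equivIntegrand e z c lam) ↔ ∀ i, 0 < (divisor e i lam).re := by
  rw [funext (equivIntegrand_eq_prod e z c lam),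
    integrable_prod_gammaKernel_iff hz fun i => cos_angle_pos (hc i)]
  exact forall_congr' fun i => divisor_div_re_pos_iff hz

lemma equivCentralCharge_eq (e : Module.Basis (Fin k) ℤ S.L) {z : ℝ} (hz : 0 < z)
    {c : Fin (n + k) → ℝ} {m : Fin (n + k) → ℤ} (hc : ∀ i, |c i - m i| < 1 / 4)
    {lam : Fin k → ℂ} (hlam : ∀ i, 0 < (divisor e i lam).re) :
    equivCentralCharge e z c lam =
      ∏ i, (Complex.exp (2 * π * Complex.I * m i * (divisor e i lam / z)) *
        ((z : ℂ) ^ (divisor e i lam / z) * Complex.Gamma (divisor e i lam / z))) := by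
  rw [equivCentralCharge, funext (equivIntegrand_eq_prod e z c lam),
    integral_fintype_prod_volume_eq_prod
      (fun i => gammaKernel z (2 * π * c i) (divisor e i lam / z))]
  exact Finset.prod_congr rfl fun i _ => integral_gammaKernel_eq hz
    (φ := 2 * π * (c i - m i)) (by ring) (abs_angle_sub_lt (hc i))
    ((divisor_div_re_pos_iff hz).2 (hlam i))

lemma equivCentralCharge_eq_prod_Gamma (e : Module.Basis (Fin k) ℤ S.L) {z : ℝ} (hz : 0 < z)
    {c : Fin (n + k) → ℝ} {m : Fin (n + k) → ℤ} (hc : ∀ i, |c i - m i| < 1 / 4)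
    {lam : Fin k → ℂ} (hlam : ∀ i, 0 < (divisor e i lam).re) :
    equivCentralCharge e z c lam =
      (∏ i, Complex.exp (2 * π * Complex.I * m i * divisor e i lam / z)) *
        ∏ i, ((z : ℂ) ^ (divisor e i lam / z) * Complex.Gamma (divisor e i lam / z)) := by
  rw [equivCentralCharge_eq e hz hc hlam, Finset.prod_mul_distrib]
  simp only [mul_div_assoc]

lemma equivCentralCharge_eq_prod_Gamma_one_add (e : Module.Basis (Fin k) ℤ S.L) {z : ℝ}
    (hz : 0 < z) {c : Fin (n + k) → ℝ} {m : Fin (n + k) → ℤ} (hc : ∀ i, |c i - m i| < 1 / 4)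
    {lam : Fin k → ℂ} (hlam : ∀ i, 0 < (divisor e i lam).re) :
    equivCentralCharge e z c lam =
      (z : ℂ) ^ (n + k) *
        (∏ i, Complex.exp (2 * π * Complex.I * m i * divisor e i lam / z)) *
        ∏ i, ((z : ℂ) ^ (divisor e i lam / z) *
          (Complex.Gamma (1 + divisor e i lam / z) / divisor e i lam)) := by
  have hpow : (z : ℂ) ^ (n + k) = ∏ _i : Fin (n + k), (z : ℂ) := by simp
  rw [equivCentralCharge_eq_prod_Gamma e hz hc hlam, hpow]
  simp only [← Finset.prod_mul_distrib]
  refine Finset.prod_congr rfl fun i _ => ?_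
  have hD : divisor e i lam ≠ 0 := fun h => by simpa [h] using hlam i
  have hz' : (z : ℂ) ≠ 0 := Complex.ofReal_ne_zero.2 hz.ne'
  rw [add_comm 1, Complex.Gamma_add_one _ (div_ne_zero hD hz')]
  field_simp

/-! ### Exponential decay along injective linear maps -/

lemma integrable_exp_neg_mul_norm {ι : Type*} [Fintype ι] {ε : ℝ} (hε : 0 < ε) :
    Integrable (fun x : ι → ℝ => Real.exp (-ε * ‖x‖)) := by
  -- The added `1` keeps the denominator nonzero for an empty index type.
  set δ : ℝ := ε / (Fintype.card ι + 1)
  have hδ : 0 < δ := by positivity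
  refine (Integrable.fintype_prod (μ := fun _ : ι => volume)
    fun _ => integrable_exp_neg_mul_abs hδ).mono' (by fun_prop) (.of_forall fun x => ?_)
  rw [Real.norm_of_nonneg (Real.exp_pos _).le, ← Real.exp_sum, Real.exp_le_exp,
    ← Finset.mul_sum, neg_mul, neg_mul, neg_le_neg_iff]
  have h1 : ∑ i, |x i| ≤ (Fintype.card ι + 1) * ‖x‖ := by
    calc ∑ i, |x i| ≤ ∑ _i : ι, ‖x‖ := Finset.sum_le_sum fun i _ => norm_le_pi_norm x i
      _ ≤ _ := by
        rw [Finset.sum_const, nsmul_eq_mul, Finset.card_univ]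
        nlinarith [norm_nonneg x]
  calc δ * ∑ i, |x i| ≤ δ * ((Fintype.card ι + 1) * ‖x‖) := by gcongr
    _ = ε * ‖x‖ := by simp only [δ]; field_simp

/-- An injective linear map in finite dimension is bounded below, so decay in the `T x i` is decay
in `‖x‖`. It serves both the `ν`-integral, via `realDivisor`, and the slice, via `linearPart`. -/
lemma integrable_prod_exp_neg_mul_abs {ι κ : Type*} [Fintype ι] [Fintype κ]
    (T : (κ → ℝ) →ₗ[ℝ] (ι → ℝ)) (hT : Function.Injective T) {ε : ι → ℝ} (hε : ∀ i, 0 < ε i) :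
    Integrable (fun x : κ → ℝ => ∏ i, Real.exp (-ε i * |T x i|)) := by
  obtain ⟨K, hK, hT⟩ := T.exists_antilipschitzWith (LinearMap.ker_eq_bot.2 hT)
  obtain ⟨δ, hδ, hδε⟩ : ∃ δ > 0, ∀ i, δ ≤ ε i := by
    rcases isEmpty_or_nonempty ι with h | h
    · exact ⟨1, one_pos, fun i => isEmptyElim i⟩
    · obtain ⟨j, hj⟩ := Finite.exists_min ε
      exact ⟨ε j, hε j, hj⟩
  have hcont : Continuous T := T.continuous_of_finiteDimensional
  refine (integrable_exp_neg_mul_norm (ι := κ) (ε := δ / K) (by positivity)).mono'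
    (Continuous.aestronglyMeasurable (by fun_prop)) (.of_forall fun x => ?_)
  rw [← Real.exp_sum, Real.norm_of_nonneg (Real.exp_pos _).le, Real.exp_le_exp]
  have h1 : ‖x‖ ≤ K * ‖T x‖ := by simpa using hT.le_mul_dist x 0
  have h2 : ‖T x‖ ≤ ∑ i, |T x i| := pi_norm_le_iff_of_nonneg
    (Finset.sum_nonneg fun i _ => abs_nonneg _) |>.2 fun i =>
      Finset.single_le_sum (f := fun i => |T x i|) (fun i _ => abs_nonneg _) (Finset.mem_univ i)
  have h3 : δ * ∑ i, |T x i| ≤ ∑ i, ε i * |T x i| := by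
    rw [Finset.mul_sum]
    exact Finset.sum_le_sum fun i _ => mul_le_mul_of_nonneg_right (hδε i) (abs_nonneg _)
  have h4 : δ / K * ‖x‖ ≤ δ * ‖T x‖ := by
    rw [div_mul_eq_mul_div, div_le_iff₀ (by positivity)]
    nlinarith
  simp only [neg_mul, Finset.sum_neg_distrib, neg_le_neg_iff]
  nlinarith

/-! ### The lattice of relations -/

lemma sum_charge_mul_b (e : Module.Basis (Fin k) ℤ S.L) (a : Fin k) (l : Fin n) :
    ∑ i, charge e a i * S.b i l = 0 := by
  have h : Fintype.linearCombination ℤ S.b (e a : Fin (n + k) → ℤ) = 0 := (e a).2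
  have := congrFun h l
  simpa [Fintype.linearCombination_apply, charge] using this

/-- The fan sequence `0 → 𝕃 → ℤʳ → N → 0` splits. -/
lemma exists_splitting (e : Module.Basis (Fin k) ℤ S.L) :
    ∃ (P : Fin k → Fin (n + k) → ℤ) (σ : Fin n → Fin (n + k) → ℤ),
      (∀ a b, ∑ i, charge e a i * P b i = if a = b then 1 else 0) ∧
      (∀ i j, ∑ a, charge e a i * P a j + ∑ l, σ l i * S.b j l = if i = j then 1 else 0) ∧
      ∀ l l', ∑ i, σ l i * S.b i l' = if l = l' then 1 else 0 := by
  set φ := Fintype.linearCombination ℤ S.b with hφ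
  have hsurj : Function.Surjective φ := by
    rw [← LinearMap.range_eq_top, hφ, Fintype.range_linearCombination, S.generate]
  -- A section exists because the `b_i` generate `N` and `N` is free.
  obtain ⟨sec, hsec⟩ := Module.projective_lifting_property φ LinearMap.id hsurj
  have hsec' : ∀ v, φ (sec v) = v := fun v => LinearMap.congr_fun hsec v
  have hφapp : ∀ v l, φ v l = ∑ i, v i * S.b i l := fun v l => by
    simp [hφ, Fintype.linearCombination_apply]
  -- The retraction onto `𝕃` complementary to `sec`. Below, `P` holds its coordinates on the
  -- standard basis and `σ` the values of `sec`.
  set p : (Fin (n + k) → ℤ) →ₗ[ℤ] S.L := LinearMap.codRestrict S.L (LinearMap.id - sec ∘ₗ φ)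
    (fun v => by
      change φ (v - sec (φ v)) = 0
      rw [map_sub, hsec', sub_self]) with hp
  have hpapp : ∀ v, (p v : Fin (n + k) → ℤ) = v - sec (φ v) := fun v => rfl
  refine ⟨fun a j => e.repr (p (fun j' => if j = j' then 1 else 0)) a,
    fun l i => sec (fun l' => if l = l' then 1 else 0) i, fun a b => ?_, fun i j => ?_,
    fun l l' => ?_⟩
  · have h1 : p (e a : Fin (n + k) → ℤ) = e a := by
      apply Subtype.ext
      rw [hpapp, show φ (e a : Fin (n + k) → ℤ) = 0 from (e a).2, map_zero, sub_zero]
    have h2 := LinearMap.pi_apply_eq_sum_univ (e.coord b ∘ₗ p) (e a : Fin (n + k) → ℤ)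
    simp only [LinearMap.comp_apply, h1, Module.Basis.coord_apply, Module.Basis.repr_self,
      smul_eq_mul] at h2
    rw [Finsupp.single_apply] at h2
    exact h2.symm
  · have h1 := congrArg (fun v : S.L => (v : Fin (n + k) → ℤ) i)
      (e.sum_repr (p (fun j' => if j = j' then 1 else 0)))
    simp only [Submodule.coe_sum, Submodule.coe_smul, Finset.sum_apply, Pi.smul_apply,
      smul_eq_mul, hpapp, Pi.sub_apply] at h1
    have h2 : φ (fun j' => if j = j' then 1 else 0) = S.b j := by
      ext l
      simp [hφapp]
    have h3 := congrFun (LinearMap.pi_apply_eq_sum_univ sec (S.b j)) i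
    simp only [Finset.sum_apply, Pi.smul_apply, smul_eq_mul] at h3
    rw [h2, h3] at h1
    simp only [charge]
    simp only [mul_comm _ (S.b j _), mul_comm ((e _ : Fin (n + k) → ℤ) i)]
    rw [h1]
    simp [eq_comm]
  · have := congrFun (hsec' (fun l' => if l = l' then 1 else 0)) l'
    rw [hφapp] at this
    simpa using this

/-- The real form of `exists_splitting`. -/
lemma exists_real_splitting (e : Module.Basis (Fin k) ℤ S.L) :
    ∃ (P : Fin k → Fin (n + k) → ℝ) (σ : Fin n → Fin (n + k) → ℝ),
      (∀ a b, ∑ i, (charge e a i : ℝ) * P b i = if a = b then 1 else 0) ∧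
      (∀ i j, ∑ a, (charge e a i : ℝ) * P a j + ∑ l, σ l i * (S.b j l : ℝ) =
        if i = j then 1 else 0) ∧
      ∀ l l', ∑ i, σ l i * (S.b i l' : ℝ) = if l = l' then 1 else 0 := by
  obtain ⟨P, σ, h1, h2, h3⟩ := exists_splitting e
  refine ⟨fun a i => P a i, fun l i => σ l i, ?_, ?_, ?_⟩
  · beta_reduce
    exact_mod_cast h1
  · beta_reduce
    exact_mod_cast h2
  · beta_reduce
    exact_mod_cast h3

/-- The real linear map `γ ↦ (D_i(γ))_i`. -/
def realDivisor (e : Module.Basis (Fin k) ℤ S.L) : (Fin k → ℝ) →ₗ[ℝ] (Fin (n + k) → ℝ) where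
  toFun γ i := ∑ a, γ a * (charge e a i : ℝ)
  map_add' x y := by
    ext i
    simp [add_mul, Finset.sum_add_distrib]
  map_smul' r x := by
    ext i
    simp [Finset.mul_sum, mul_assoc]

lemma realDivisor_apply (e : Module.Basis (Fin k) ℤ S.L) (γ : Fin k → ℝ) (i : Fin (n + k)) :
    realDivisor e γ i = ∑ a, γ a * (charge e a i : ℝ) := rfl

lemma mem_positiveCone {e : Module.Basis (Fin k) ℤ S.L} {γ : Fin k → ℝ} :
    γ ∈ positiveCone e ↔ ∀ i, 0 < realDivisor e γ i := Iff.rfl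

lemma continuous_realDivisor (e : Module.Basis (Fin k) ℤ S.L) : Continuous (realDivisor e) :=
  LinearMap.continuous_of_finiteDimensional _

lemma realDivisor_injective (e : Module.Basis (Fin k) ℤ S.L) :
    Function.Injective (realDivisor e) := by
  obtain ⟨P, -, h1, -, -⟩ := exists_real_splitting e
  have hleft : ∀ γ b, ∑ i, realDivisor e γ i * P b i = γ b := fun γ b => by
    simp only [realDivisor_apply, Finset.sum_mul]
    rw [Finset.sum_comm]
    simp only [mul_assoc, ← Finset.mul_sum, h1]
    simp
  intro x y hxy
  ext b
  rw [← hleft x b, hxy, hleft]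

/-- Apply the splitting of the identity to `α`: the part through `N` vanishes on a relation, and the
rest lies in the image of `𝕃_ℝ`. -/
lemma exists_realDivisor_eq (e : Module.Basis (Fin k) ℤ S.L) {α : Fin (n + k) → ℝ}
    (hα : ∑ i, α i • toReal (S.b i) = 0) : ∃ γ, realDivisor e γ = α := by
  obtain ⟨P, σ, -, h2, -⟩ := exists_real_splitting e
  have hα' : ∀ l, ∑ j, α j * (S.b j l : ℝ) = 0 := fun l => by
    simpa [toReal] using congrFun hα l
  refine ⟨fun a => ∑ j, P a j * α j, ?_⟩
  ext i
  have h : ∑ j, (∑ a, (charge e a i : ℝ) * P a j + ∑ l, σ l i * (S.b j l : ℝ)) * α j = α i := by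
    simp [h2]
  have h0 : ∑ j, (∑ l, σ l i * (S.b j l : ℝ)) * α j = 0 := by
    simp only [Finset.sum_mul]
    rw [Finset.sum_comm]
    refine Finset.sum_eq_zero fun l _ => ?_
    rw [← mul_zero (σ l i), ← hα' l, Finset.mul_sum]
    exact Finset.sum_congr rfl fun j _ => by ring
  simp only [add_mul, Finset.sum_add_distrib, h0, add_zero] at h
  rw [realDivisor_apply, ← h]
  simp only [Finset.sum_mul]
  rw [Finset.sum_comm]
  exact Finset.sum_congr rfl fun j _ => Finset.sum_congr rfl fun a _ => by ring

/-- Completeness of the fan produces a strictly positive relation between the `b_i`. -/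
lemma exists_positive_relation (S : StackyFan n k) :
    ∃ α : Fin (n + k) → ℝ, (∀ i, 0 < α i) ∧ ∑ i, α i • toReal (S.b i) = 0 := by
  have h : ∀ j, ∃ α : Fin (n + k) → ℝ, (∀ i, 0 ≤ α i) ∧ 0 < α j ∧
      ∑ i, α i • toReal (S.b i) = 0 := by
    intro j
    -- Moving `-b_j`, written in a cone, to the other side gives a nonnegative relation with
    -- coefficient at least `1` at `j`; these are summed over `j`.
    obtain ⟨σ, -, s, hs, hx⟩ := S.complete (-toReal (S.b j))
    refine ⟨fun i => (if i = j then 1 else 0) + if i ∈ σ then s i else 0, fun i => ?_, ?_, ?_⟩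
    · have : 0 ≤ if i ∈ σ then s i else 0 := by
        split_ifs with h
        exacts [hs i h, le_rfl]
      positivity
    · have : 0 ≤ if j ∈ σ then s j else 0 := by
        split_ifs with h
        exacts [hs j h, le_rfl]
      simp only [if_true]
      positivity
    · simp only [add_smul, ite_smul, one_smul, zero_smul, Finset.sum_add_distrib,
        Finset.sum_ite_eq', Finset.mem_univ, if_true, Finset.sum_ite_mem, Finset.univ_inter]
      rw [← hx, add_neg_cancel]
  choose α h0 h1 h2 using h
  refine ⟨fun i => ∑ j, α j i, fun i => Finset.sum_pos' (fun j _ => h0 j i)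
    ⟨i, Finset.mem_univ i, h1 i⟩, ?_⟩
  simp only [Finset.sum_smul]
  rw [Finset.sum_comm]
  exact Finset.sum_eq_zero fun j _ => h2 j

lemma positiveCone_nonempty (e : Module.Basis (Fin k) ℤ S.L) : (positiveCone e).Nonempty := by
  obtain ⟨α, hα, h⟩ := exists_positive_relation S
  obtain ⟨γ, rfl⟩ := exists_realDivisor_eq e h
  exact ⟨γ, hα⟩

lemma isOpen_positiveCone (e : Module.Basis (Fin k) ℤ S.L) : IsOpen (positiveCone e) := by
  have : positiveCone e = ⋂ i, {γ | 0 < realDivisor e γ i} := by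
    ext γ
    simp [mem_positiveCone]
  rw [this]
  exact isOpen_iInter_of_finite fun i => isOpen_lt continuous_const
    ((continuous_apply i).comp (continuous_realDivisor e))

/-! ### The slice and its charts -/

lemma mem_slice_iff {e : Module.Basis (Fin k) ℤ S.L} {c : Fin (n + k) → ℝ} {t : Fin k → ℂ}
    {x : Fin (n + k) → ℂ} :
    x ∈ slice e c t ↔ (∀ i, (x i).im = 2 * π * c i) ∧
      ∀ a, ∑ i, (charge e a i : ℝ) * (x i).re = (t a).re := by
  simp [slice, mirrorCycle, Htilde, Complex.re_sum]

lemma slice_subset_mirrorFibre (e : Module.Basis (Fin k) ℤ S.L) {c : Fin (n + k) → ℝ}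
    {t : Fin k → ℂ} (ht : ∀ a, (t a).im = 2 * π * ∑ i, (charge e a i : ℝ) * c i) :
    slice e c t ⊆ mirrorFibre e t := by
  intro x hx a
  obtain ⟨him, hre⟩ := mem_slice_iff.1 hx
  apply Complex.ext
  · rw [← hre a]
    simp [Htilde, Complex.re_sum]
  · rw [ht a, Finset.mul_sum]
    simp only [Htilde, Complex.im_sum]
    refine Finset.sum_congr rfl fun i _ => ?_
    simp [him i]
    ring

lemma nonempty_chart (e : Module.Basis (Fin k) ℤ S.L) (c : Fin (n + k) → ℝ) (t : Fin k → ℂ) :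
    Nonempty (Chart e (slice e c t)) := by
  obtain ⟨P, σ, h1, h2, h3⟩ := exists_real_splitting e
  have hb : ∀ a l, ∑ i, (charge e a i : ℝ) * (S.b i l : ℝ) = 0 := fun a l => by
    exact_mod_cast sum_charge_mul_b e a l
  -- The directions are the coordinate functions of the `b_i`, which span the common kernel of the
  -- charges; `P` is dual to the charges, so it supplies both the normals and a base point with the
  -- right `Re H̃_a`.
  refine ⟨⟨fun i => ((∑ a, (t a).re * P a i : ℝ) : ℂ) + (2 * π * c i : ℝ) * Complex.I,
    fun l i => S.b i l, P, ?_, ?_, h1⟩⟩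
  · rw [Fintype.linearIndependent_iff]
    intro g hg l
    have h : ∑ i, σ l i * (∑ l', g l' * (S.b i l' : ℝ)) = g l := by
      simp only [Finset.mul_sum]
      rw [Finset.sum_comm]
      simp only [mul_left_comm _ (g _), ← Finset.mul_sum, h3]
      simp
    rw [← h]
    refine Finset.sum_eq_zero fun i _ => ?_
    have := congrFun hg i
    simp only [Finset.sum_apply, Pi.smul_apply, smul_eq_mul, Pi.zero_apply] at this
    rw [this, mul_zero]
  · ext x
    rw [mem_slice_iff]
    constructor
    · rintro ⟨s, rfl⟩
      refine ⟨fun i => by simp, fun a => ?_⟩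
      have hre : ∀ i, ((((∑ a, (t a).re * P a i : ℝ) : ℂ) + (2 * π * c i : ℝ) * Complex.I +
          ((∑ j, s j * (S.b i j : ℝ) : ℝ) : ℂ)).re) =
          ∑ a, (t a).re * P a i + ∑ j, s j * (S.b i j : ℝ) := fun i => by
        simp only [Complex.add_re, Complex.ofReal_re, Complex.re_ofReal_mul, Complex.I_re]
        ring
      simp only [hre, mul_add, Finset.sum_add_distrib, Finset.mul_sum]
      rw [Finset.sum_comm, Finset.sum_comm (f := fun i j => (charge e a i : ℝ) * _)]
      simp only [mul_left_comm ((charge e a _ : ℝ)), ← Finset.mul_sum, h1, hb]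
      simp
    · rintro ⟨him, hre⟩
      refine ⟨fun l => ∑ i, σ l i * (x i).re, ?_⟩
      ext j
      apply Complex.ext
      · simp only [Complex.add_re, Complex.ofReal_re, Complex.re_ofReal_mul, Complex.I_re,
          mul_zero, add_zero]
        have h : ∑ i, (∑ a, (charge e a i : ℝ) * P a j + ∑ l, σ l i * (S.b j l : ℝ)) *
            (x i).re = (x j).re := by simp [h2]
        rw [← h]
        simp only [add_mul, Finset.sum_add_distrib, ← hre, Finset.sum_mul]
        rw [Finset.sum_comm, Finset.sum_comm (f := fun (l : Fin n) i => _ * _ * (S.b j l : ℝ))]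
        congr 1 <;> exact Finset.sum_congr rfl fun i _ => Finset.sum_congr rfl fun a _ => by ring
      · simp [him j]

namespace Chart

variable {e : Module.Basis (Fin k) ℤ S.L} {c : Fin (n + k) → ℝ} {t : Fin k → ℂ}

lemma point_mem (χ : Chart e (slice e c t)) (s : Fin n → ℝ) : χ.point s ∈ slice e c t :=
  χ.range_eq.subset (mem_range_self s)

lemma origin_im (χ : Chart e (slice e c t)) (i : Fin (n + k)) :
    (χ.origin i).im = 2 * π * c i := by
  simpa [point] using (mem_slice_iff.1 (χ.point_mem 0)).1 i

lemma sum_charge_mul_origin_re (χ : Chart e (slice e c t)) (a : Fin k) :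
    ∑ i, (charge e a i : ℝ) * (χ.origin i).re = (t a).re := by
  simpa [point] using (mem_slice_iff.1 (χ.point_mem 0)).2 a

lemma sum_charge_mul_dir (χ : Chart e (slice e c t)) (a : Fin k) (j : Fin n) :
    ∑ i, (charge e a i : ℝ) * χ.dir j i = 0 := by
  have h := (mem_slice_iff.1 (χ.point_mem (Pi.single j 1))).2 a
  simp only [point, Complex.add_re, Complex.ofReal_re, mul_add, Finset.sum_add_distrib,
    χ.sum_charge_mul_origin_re] at h
  simpa [Pi.single_apply] using h

/-- Pairing a linear relation among the rows with the charges kills the directions and isolates each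
normal coefficient; the directions themselves are independent. -/
lemma density_pos (χ : Chart e (slice e c t)) : 0 < χ.density := by
  rw [density, abs_pos]
  intro hdet
  obtain ⟨v, hv, h⟩ := Matrix.exists_vecMul_eq_zero_iff.2 hdet
  have hi : ∀ i, ∑ j, v (Fin.castAdd k j) * χ.dir j i +
      ∑ b, v (Fin.natAdd n b) * χ.normal b i = 0 := fun i => by
    have := congrFun h i
    simpa [Matrix.vecMul, dotProduct, Fin.sum_univ_add] using this
  have hnormal : ∀ a, v (Fin.natAdd n a) = 0 := fun a => by
    have h0 : ∑ i, (charge e a i : ℝ) * (∑ j, v (Fin.castAdd k j) * χ.dir j i +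
        ∑ b, v (Fin.natAdd n b) * χ.normal b i) = 0 := by simp [hi]
    simp only [mul_add, Finset.sum_add_distrib, Finset.mul_sum] at h0
    rw [Finset.sum_comm, Finset.sum_comm (f := fun i b => (charge e a i : ℝ) * _)] at h0
    simp only [mul_left_comm ((charge e a _ : ℝ)), ← Finset.mul_sum, χ.sum_charge_mul_dir,
      χ.normal_dual] at h0
    simpa using h0
  have hdir : ∀ j, v (Fin.castAdd k j) = 0 :=
    Fintype.linearIndependent_iff.1 χ.dir_indep (fun j => v (Fin.castAdd k j)) (by
      ext i
      simpa [hnormal] using hi i)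
  apply hv
  ext i
  exact Fin.addCases hdir hnormal i

end Chart

/-! ### Fourier inversion at the origin -/

open scoped FourierTransform in
-- Fourier inversion on Euclidean space, evaluated at `0` where the outer character is trivial.
-- Rescaling the frequency by `2π` produces `(2π)⁻ᵏ`.
lemma integral_integral_exp_mul_eq {g : (Fin k → ℝ) → ℂ} (hg : Integrable g)
    (hcont : ContinuousAt g 0)
    (hint : Integrable (fun ν : Fin k → ℝ =>
      ∫ h, Complex.exp ((∑ a, ν a * h a : ℝ) * Complex.I) * g h)) :
    ((2 * π : ℂ) ^ k)⁻¹ * ∫ ν : Fin k → ℝ,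
      ∫ h, Complex.exp ((∑ a, ν a * h a : ℝ) * Complex.I) * g h = g 0 := by
  set ψ : (Fin k → ℝ) → ℂ := fun ν =>
    ∫ h, Complex.exp ((∑ a, ν a * h a : ℝ) * Complex.I) * g h with hψ
  set G : EuclideanSpace ℝ (Fin k) → ℂ := fun v => g v.ofLp with hG
  have hmp := PiLp.volume_preserving_ofLp (Fin k)
  have hemb : MeasurableEmbedding (@WithLp.ofLp 2 (Fin k → ℝ)) :=
    (MeasurableEquiv.toLp 2 (Fin k → ℝ)).symm.measurableEmbedding
  have hGint : Integrable G := (hmp.integrable_comp_emb hemb).2 hg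
  have hinv : ∀ w, 𝓕⁻ G w = ψ ((2 * π) • w.ofLp) := fun w => by
    rw [Real.fourierInv_eq', hψ]
    simp only
    rw [← hmp.integral_comp hemb]
    refine integral_congr_ae (.of_forall fun v => ?_)
    simp only [hG, smul_eq_mul, PiLp.inner_apply, RCLike.inner_apply, conj_trivial, Pi.smul_apply,
      Finset.mul_sum, mul_assoc]
  have hfour : ∀ w, 𝓕 G w = ψ ((-(2 * π)) • w.ofLp) := fun w => by
    rw [← neg_neg w, ← Real.fourierInv_eq_fourier_neg, hinv]
    simp
  have hFint : Integrable (𝓕 G) := by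
    rw [funext hfour]
    exact (hmp.integrable_comp_emb hemb (g := fun x => ψ ((-(2 * π)) • x))).2
      ((integrable_comp_smul_iff volume ψ (by simp [Real.pi_ne_zero])).2 hint)
  have hGcont : ContinuousAt G 0 :=
    ContinuousAt.comp (g := g) (by simpa using hcont) (PiLp.continuous_ofLp 2 _).continuousAt
  have key := hGint.fourier_fourierInv_eq hFint hGcont
  rw [Real.fourier_eq'] at key
  simp only [inner_zero_right, mul_zero, Complex.ofReal_zero, zero_mul, Complex.exp_zero,
    one_smul, hinv] at key
  rw [hmp.integral_comp hemb (fun x => ψ ((2 * π) • x)), Measure.integral_comp_smul] at key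
  rw [Module.finrank_fin_fun, abs_of_pos (by positivity), Complex.real_smul] at key
  rw [show g 0 = G 0 from rfl, ← key]
  push_cast
  rfl

/-! ### Affine coordinates adapted to a chart -/

lemma measurePreserving_append :
    MeasurePreserving (fun p : (Fin n → ℝ) × (Fin k → ℝ) => Fin.append p.1 p.2) := by
  have h := (volume_measurePreserving_sumPiEquivProdPi_symm (fun _ : Fin n ⊕ Fin k => ℝ)).trans
    (volume_measurePreserving_piCongrLeft (fun _ : Fin (n + k) => ℝ) finSumFinEquiv)
  convert! h using 1
  ext p i
  refine Fin.addCases (fun j => ?_) (fun j => ?_) i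
  · have := Equiv.piCongrLeft_apply_apply (fun _ : Fin (n + k) => ℝ) finSumFinEquiv
      ((Equiv.sumPiEquivProdPi (fun _ : Fin n ⊕ Fin k => ℝ)).symm p) (Sum.inl j)
    simp only [finSumFinEquiv_apply_left] at this
    rw [Fin.append_left]
    exact this.symm
  · have := Equiv.piCongrLeft_apply_apply (fun _ : Fin (n + k) => ℝ) finSumFinEquiv
      ((Equiv.sumPiEquivProdPi (fun _ : Fin n ⊕ Fin k => ℝ)).symm p) (Sum.inr j)
    simp only [finSumFinEquiv_apply_right] at this
    rw [Fin.append_right]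
    exact this.symm

namespace Chart

variable {e : Module.Basis (Fin k) ℤ S.L} {c : Fin (n + k) → ℝ} {t : Fin k → ℂ}

/-- The affine coordinates on `ℝʳ` in which the real part of the plane is `{h = 0}`. -/
def realPoint (χ : Chart e (slice e c t)) (p : (Fin n → ℝ) × (Fin k → ℝ)) : Fin (n + k) → ℝ :=
  fun i => (χ.origin i).re + (∑ j, p.1 j * χ.dir j i + ∑ b, p.2 b * χ.normal b i)

lemma continuous_realPoint (χ : Chart e (slice e c t)) : Continuous χ.realPoint := by
  unfold realPoint
  fun_prop

lemma sum_charge_mul_realPoint (χ : Chart e (slice e c t)) (a : Fin k)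
    (p : (Fin n → ℝ) × (Fin k → ℝ)) :
    ∑ i, (charge e a i : ℝ) * χ.realPoint p i = (t a).re + p.2 a := by
  simp only [realPoint, mul_add, Finset.sum_add_distrib, Finset.mul_sum,
    χ.sum_charge_mul_origin_re]
  rw [Finset.sum_comm, Finset.sum_comm (f := fun i b => (charge e a i : ℝ) * _)]
  simp only [mul_left_comm ((charge e a _ : ℝ)), ← Finset.mul_sum, χ.sum_charge_mul_dir,
    χ.normal_dual]
  simp

lemma point_eq_cyclePoint (χ : Chart e (slice e c t)) (s : Fin n → ℝ) :
    χ.point s = cyclePoint c (χ.realPoint (s, 0)) := by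
  ext i
  apply Complex.ext <;> simp [point, cyclePoint, realPoint, χ.origin_im]

lemma map_realPoint (χ : Chart e (slice e c t)) :
    Measure.map χ.realPoint volume = ENNReal.ofReal χ.density⁻¹ • volume := by
  set M : Matrix (Fin (n + k)) (Fin (n + k)) ℝ := (Matrix.of (Fin.append χ.dir χ.normal)).transpose
  have hdet : |M.det| = χ.density := by rw [Matrix.det_transpose, density]
  have hM : M.det ≠ 0 := abs_pos.1 (hdet ▸ χ.density_pos)
  have hcomp : χ.realPoint = (fun y => (fun i => (χ.origin i).re) + y) ∘ Matrix.toLin' M ∘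
      fun p : (Fin n → ℝ) × (Fin k → ℝ) => Fin.append p.1 p.2 := by
    ext p i
    simp [realPoint, M, Matrix.mulVec, dotProduct, Fin.sum_univ_add, mul_comm]
  have hlin : Measurable (Matrix.toLin' M) :=
    (LinearMap.continuous_of_finiteDimensional _).measurable
  rw [hcomp, ← Measure.map_map (measurable_const_add _)
    (hlin.comp measurePreserving_append.measurable),
    ← Measure.map_map hlin measurePreserving_append.measurable, measurePreserving_append.map_eq,
    Real.map_matrix_volume_pi_eq_smul_volume_pi hM, Measure.map_smul,
    (measurePreserving_add_left volume _).map_eq, abs_inv, hdet]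

lemma integrable_comp_realPoint (χ : Chart e (slice e c t)) {F : (Fin (n + k) → ℝ) → ℂ}
    (hF : Integrable F) : Integrable (fun p => F (χ.realPoint p)) := by
  refine Integrable.comp_measurable (f := χ.realPoint) ?_ χ.continuous_realPoint.measurable
  rw [χ.map_realPoint]
  exact hF.smul_measure ENNReal.ofReal_ne_top

lemma integral_eq_integral_realPoint (χ : Chart e (slice e c t)) {F : (Fin (n + k) → ℝ) → ℂ}
    (hF : Integrable F) : ∫ y, F y = ∫ p, F (χ.realPoint p) * χ.density := by
  rw [integral_mul_const, ← integral_map χ.continuous_realPoint.aemeasurable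
    (by rw [χ.map_realPoint]; exact (hF.smul_measure ENNReal.ofReal_ne_top).1),
    χ.map_realPoint, integral_smul_measure,
    ENNReal.toReal_ofReal (inv_nonneg.2 χ.density_pos.le), Complex.real_smul, mul_right_comm,
    ← Complex.ofReal_mul, inv_mul_cancel₀ χ.density_pos.ne', Complex.ofReal_one, one_mul]

end Chart

/-! ### Holomorphy and decay of the central charge on the tube over the positive cone -/

lemma tubePoint_re {γ ν : Fin k → ℝ} : (fun a => (tubePoint γ ν a).re) = γ := by
  ext a
  simp [tubePoint]

lemma continuous_tubePoint (γ : Fin k → ℝ) : Continuous (tubePoint γ) := by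
  unfold tubePoint
  fun_prop

lemma divisor_re (e : Module.Basis (Fin k) ℤ S.L) (i : Fin (n + k)) (u : Fin k → ℂ) :
    (divisor e i u).re = realDivisor e (fun a => (u a).re) i := by
  simp [divisor, realDivisor_apply, Complex.re_sum]

lemma divisor_tubePoint (e : Module.Basis (Fin k) ℤ S.L) (i : Fin (n + k)) (γ ν : Fin k → ℝ) :
    divisor e i (tubePoint γ ν) = realDivisor e γ i + realDivisor e ν i * Complex.I := by
  apply Complex.ext <;> simp [divisor, realDivisor_apply, Complex.re_sum, Complex.im_sum, tubePoint]

lemma differentiable_divisor (e : Module.Basis (Fin k) ℤ S.L) (i : Fin (n + k)) :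
    Differentiable ℂ (divisor e i) := by
  unfold divisor
  fun_prop

lemma divisor_smul_re_pos {e : Module.Basis (Fin k) ℤ S.L} {z : ℝ} (hz : 0 < z) {u : Fin k → ℂ}
    (hu : (fun a => (u a).re) ∈ positiveCone e) (i : Fin (n + k)) :
    0 < (divisor e i fun a => z * u a).re := by
  rw [divisor_smul, Complex.re_ofReal_mul, divisor_re]
  exact mul_pos hz (hu i)

lemma equivCentralCharge_smul_eq (e : Module.Basis (Fin k) ℤ S.L) {z : ℝ} (hz : 0 < z)
    {c : Fin (n + k) → ℝ} {m : Fin (n + k) → ℤ} (hc : ∀ i, |c i - m i| < 1 / 4) {u : Fin k → ℂ}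
    (hu : (fun a => (u a).re) ∈ positiveCone e) :
    equivCentralCharge e z c (fun a => z * u a) =
      ∏ i, (Complex.exp (2 * π * Complex.I * m i * divisor e i u) *
        ((z : ℂ) ^ divisor e i u * Complex.Gamma (divisor e i u))) := by
  rw [equivCentralCharge_eq e hz hc (divisor_smul_re_pos hz hu)]
  simp only [divisor_smul, mul_div_cancel_left₀ _ (Complex.ofReal_ne_zero.2 hz.ne')]

lemma differentiableOn_equivCentralCharge (e : Module.Basis (Fin k) ℤ S.L) {z : ℝ} (hz : 0 < z)
    {c : Fin (n + k) → ℝ} {m : Fin (n + k) → ℤ} (hc : ∀ i, |c i - m i| < 1 / 4) :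
    DifferentiableOn ℂ (fun u : Fin k → ℂ => equivCentralCharge e z c (fun a => z * u a))
      {u : Fin k → ℂ | (fun a => (u a).re) ∈ positiveCone e} := by
  refine DifferentiableOn.congr (fun (u : Fin k → ℂ) hu => ?_) fun u hu => equivCentralCharge_smul_eq e hz hc hu
  have hfactor : ∀ i, DifferentiableAt ℂ (fun u => Complex.exp (2 * π * Complex.I * m i *
      divisor e i u) * ((z : ℂ) ^ divisor e i u * Complex.Gamma (divisor e i u))) u := by
    intro i
    have hd : DifferentiableAt ℂ (divisor e i) u := differentiable_divisor e i u
    have hpos : 0 < (divisor e i u).re := by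
      rw [divisor_re]
      exact hu i
    refine (hd.const_mul _).cexp.mul ((hd.const_cpow (.inl (Complex.ofReal_ne_zero.2 hz.ne'))).mul
      (DifferentiableAt.comp u (Complex.differentiableAt_Gamma _ fun j h => ?_) hd))
    rw [h] at hpos
    have : (0 : ℝ) ≤ j := j.cast_nonneg
    simp at hpos
    linarith
  exact (HasFDerivAt.finsetProd (u := Finset.univ) fun i _ =>
    (hfactor i).hasFDerivAt).differentiableAt.differentiableWithinAt

lemma continuous_fourierIntegrand {U : Set (Fin k → ℝ)} {f : (Fin k → ℂ) → ℂ}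
    (hf : DifferentiableOn ℂ f {u | (fun a => (u a).re) ∈ U}) (t : Fin k → ℂ) {γ : Fin k → ℝ}
    (hγ : γ ∈ U) : Continuous (fourierIntegrand f t γ) := by
  have h1 : Continuous fun ν => f (tubePoint γ ν) :=
    hf.continuousOn.comp_continuous (continuous_tubePoint γ) fun ν => by
      rw [mem_ofPred_eq, tubePoint_re]
      exact hγ
  have h2 : ∀ a, Continuous fun ν => tubePoint γ ν a := fun a =>
    (continuous_apply a).comp (continuous_tubePoint γ)
  exact h1.mul (continuous_finsetSum _ fun a _ => (h2 a).mul continuous_const).neg.cexp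

/-- The condition on `Im t` splits the growth in `ν` into one factor per `D_i(ν)`, to be matched
against the decay of the corresponding Gamma factor. -/
lemma norm_exp_neg_sum_tubePoint_mul (e : Module.Basis (Fin k) ℤ S.L) {c : Fin (n + k) → ℝ}
    {t : Fin k → ℂ} (ht : ∀ a, (t a).im = 2 * π * ∑ i, (charge e a i : ℝ) * c i)
    (γ ν : Fin k → ℝ) :
    ‖Complex.exp (-∑ a, tubePoint γ ν a * t a)‖ =
      Real.exp (-∑ a, γ a * (t a).re) * ∏ i, Real.exp (2 * π * c i * realDivisor e ν i) := by
  rw [Complex.norm_exp, ← Real.exp_sum, ← Real.exp_add]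
  congr 1
  have h : ∑ i, 2 * π * c i * realDivisor e ν i = ∑ a, ν a * (t a).im := by
    simp only [ht, realDivisor_apply, Finset.mul_sum]
    rw [Finset.sum_comm]
    exact Finset.sum_congr rfl fun a _ => Finset.sum_congr rfl fun i _ => by ring
  rw [h, Complex.neg_re, Complex.re_sum, ← Finset.sum_neg_distrib, ← Finset.sum_neg_distrib,
    ← Finset.sum_add_distrib]
  refine Finset.sum_congr rfl fun a _ => ?_
  simp [tubePoint, Complex.mul_re]
  ring

/-- Exponential decay of the Fourier integrand, locally uniform in `γ`. -/
lemma exists_norm_fourierIntegrand_le (e : Module.Basis (Fin k) ℤ S.L) {z : ℝ} (hz : 0 < z)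
    {c c' : Fin (n + k) → ℝ} {m : Fin (n + k) → ℤ} (hc : ∀ i, |c i - m i| < 1 / 4)
    (hc' : ∀ i, |c' i - m i| < 1 / 4) {t : Fin k → ℂ}
    (ht : ∀ a, (t a).im = 2 * π * ∑ i, (charge e a i : ℝ) * c' i) :
    ∃ (A : (Fin k → ℝ) → ℝ) (ε : Fin (n + k) → ℝ), ContinuousOn A (positiveCone e) ∧
      (∀ i, 0 < ε i) ∧ ∀ γ ∈ positiveCone e, ∀ ν,
        ‖fourierIntegrand (fun u => equivCentralCharge e z c (fun a => z * u a)) t γ ν‖ ≤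
          A γ * ∏ i, Real.exp (-ε i * |realDivisor e ν i|) := by
  -- Room between the angle `|2π(c'_i - m_i)|` and `π/2`: Gamma decays at rate `β_i`, the
  -- exponentials grow at most at the rate of the angle, and `ε_i` is the difference.
  choose β hβ hβ' using fun i => exists_between (abs_angle_sub_lt (hc' i))
  have hβ0 : ∀ i, 0 ≤ β i := fun i => (abs_nonneg _).trans (hβ i).le
  have hcos : ∀ i, 0 < Real.cos (β i) := fun i =>
    Real.cos_pos_of_mem_Ioo ⟨by linarith [hβ0 i, Real.pi_pos], hβ' i⟩
  refine ⟨fun γ => Real.exp (-∑ a, γ a * (t a).re) * ∏ i, (z ^ realDivisor e γ i *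
      (Real.Gamma (realDivisor e γ i) * (Real.cos (β i))⁻¹ ^ realDivisor e γ i)),
    fun i => β i - |2 * π * (c' i - m i)|, ?_, fun i => sub_pos.2 (hβ i), fun γ hγ ν => ?_⟩
  · have hD : ∀ i, Continuous fun γ => realDivisor e γ i := fun i =>
      (continuous_apply i).comp (continuous_realDivisor e)
    refine ContinuousOn.mul (by fun_prop) (continuousOn_finsetProd _ fun i _ => ?_)
    refine ContinuousOn.mul (continuous_const.rpow (hD i)
      fun _ => .inl hz.ne').continuousOn (ContinuousOn.mul (fun γ hγ => ?_) ?_)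
    · have hpos := mem_positiveCone.1 hγ i
      have hG : ContinuousAt Real.Gamma (realDivisor e γ i) :=
        (Real.differentiableAt_Gamma fun j => by
          have : (0 : ℝ) ≤ j := j.cast_nonneg
          linarith).continuousAt
      exact (ContinuousAt.comp (f := fun γ => realDivisor e γ i) hG
        (hD i).continuousAt).continuousWithinAt
    · exact (continuous_const.rpow (hD i) fun _ => .inl (inv_pos.2 (hcos i)).ne').continuousOn
  · dsimp only
    rw [fourierIntegrand, norm_mul, norm_exp_neg_sum_tubePoint_mul e ht,
      equivCentralCharge_smul_eq e hz hc (by rw [tubePoint_re]; exact hγ), norm_prod,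
      mul_left_comm, mul_assoc (Real.exp _), ← Finset.prod_mul_distrib, ← Finset.prod_mul_distrib]
    refine mul_le_mul_of_nonneg_left (Finset.prod_le_prod (fun i _ => by positivity) fun i _ => ?_)
      (Real.exp_pos _).le
    have hpos := mem_positiveCone.1 hγ i
    set α := realDivisor e γ i
    set τ := realDivisor e ν i
    rw [divisor_tubePoint, norm_mul, norm_mul, Complex.norm_cpow_eq_rpow_re_of_pos hz,
      Complex.norm_exp]
    have hre : (2 * π * Complex.I * m i * (α + τ * Complex.I) : ℂ).re = -(2 * π * m i * τ) := by
      rw [show (2 * π * Complex.I * m i * (α + τ * Complex.I) : ℂ) =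
        ((-(2 * π * m i * τ) : ℝ) : ℂ) + ((2 * π * m i * α : ℝ) : ℂ) * Complex.I by
          push_cast
          linear_combination (2 * π * m i * τ : ℂ) * Complex.I_mul_I]
      simp
    rw [hre]
    have hG := norm_Gamma_le_exp_abs (τ := τ) hpos (hβ0 i) (hβ' i)
    have hexp : Real.exp (-(2 * π * m i * τ)) * Real.exp (-(β i * |τ|)) *
        Real.exp (2 * π * c' i * τ) ≤ Real.exp (-(β i - |2 * π * (c' i - m i)|) * |τ|) := by
      rw [← Real.exp_add, ← Real.exp_add, Real.exp_le_exp]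
      have := le_abs_self (2 * π * (c' i - m i) * τ)
      rw [abs_mul] at this
      linarith
    have hB : 0 ≤ z ^ α * (Real.Gamma α * (Real.cos (β i))⁻¹ ^ α) :=
      mul_nonneg (by positivity) (mul_nonneg (Real.Gamma_pos_of_pos hpos).le
        (Real.rpow_nonneg (inv_pos.2 (hcos i)).le _))
    have hαre : ((α : ℂ) + τ * Complex.I).re = α := by simp
    rw [hαre]
    calc _ ≤ Real.exp (-(2 * π * m i * τ)) * (z ^ α * (Real.exp (-(β i * |τ|)) *
          (Real.Gamma α * (Real.cos (β i))⁻¹ ^ α))) * Real.exp (2 * π * c' i * τ) := by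
            gcongr
      _ = z ^ α * (Real.Gamma α * (Real.cos (β i))⁻¹ ^ α) * (Real.exp (-(2 * π * m i * τ)) *
          Real.exp (-(β i * |τ|)) * Real.exp (2 * π * c' i * τ)) := by ring
      _ ≤ _ := by gcongr

/-! ### The fibre integrals -/

namespace Chart

variable {e : Module.Basis (Fin k) ℤ S.L} {c : Fin (n + k) → ℝ} {t : Fin k → ℂ}

/-- The integrand of the fibre integral over the translate of the plane by `∑ h_a normal_a`. -/
def fibreIntegrand (χ : Chart e (slice e c t)) (z : ℝ) (p : (Fin n → ℝ) × (Fin k → ℝ)) : ℂ :=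
  Complex.exp (-W (cyclePoint c (χ.realPoint p)) / z) * χ.density

lemma continuous_fibreIntegrand (χ : Chart e (slice e c t)) (z : ℝ) :
    Continuous (χ.fibreIntegrand z) := by
  have h : ∀ i, Continuous fun p => χ.realPoint p i := fun i =>
    (continuous_apply i).comp χ.continuous_realPoint
  unfold fibreIntegrand W cyclePoint
  fun_prop

lemma integrand_eq_fibreIntegrand (χ : Chart e (slice e c t)) (z : ℝ) (s : Fin n → ℝ) :
    χ.integrand z s = χ.fibreIntegrand z (s, 0) := by
  rw [integrand, fibreIntegrand, point_eq_cyclePoint]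

/-- The linear part of the parametrization of the plane. -/
def linearPart (χ : Chart e (slice e c t)) : (Fin n → ℝ) →ₗ[ℝ] (Fin (n + k) → ℝ) :=
  Fintype.linearCombination ℝ χ.dir

lemma linearPart_apply (χ : Chart e (slice e c t)) (s : Fin n → ℝ) (i : Fin (n + k)) :
    χ.linearPart s i = ∑ j, s j * χ.dir j i := by
  simp [linearPart, Fintype.linearCombination_apply]

lemma linearPart_injective (χ : Chart e (slice e c t)) : Function.Injective χ.linearPart :=
  χ.dir_indep.fintypeLinearCombination_injective

lemma norm_exp_neg_W_div {r : ℕ} (c y : Fin r → ℝ) (z : ℝ) :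
    ‖Complex.exp (-W (cyclePoint c y) / z)‖ =
      ∏ i, Real.exp (-(Real.cos (2 * π * c i) / z) * Real.exp (y i)) := by
  rw [Complex.norm_exp, ← Real.exp_sum, Complex.div_ofReal_re, W, Complex.neg_re, Complex.re_sum,
    ← Finset.sum_neg_distrib, Finset.sum_div]
  congr 1
  refine Finset.sum_congr rfl fun i _ => ?_
  rw [Complex.exp_re]
  simp [cyclePoint]
  ring

/-- The double exponential alone gives no decay as a coordinate tends to `-∞`. With `α = D(γ)` for
`γ` in the positive cone, `∑ α_i y_i` depends only on `h`, so `α_i y_i` may be added to each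
exponent at the cost of a factor constant in `s`. -/
lemma exists_norm_fibreIntegrand_le (χ : Chart e (slice e c t)) {z : ℝ} (hz : 0 < z)
    (hcos : ∀ i, 0 < Real.cos (2 * π * c i)) :
    ∃ (B : (Fin k → ℝ) → ℝ) (α : Fin (n + k) → ℝ), Continuous B ∧ (∀ i, 0 < α i) ∧
      ∀ s h, ‖χ.fibreIntegrand z (s, h)‖ ≤
        B h * ∏ i, Real.exp (-α i * |χ.linearPart s i|) := by
  obtain ⟨γ, hγ⟩ := positiveCone_nonempty e
  set α := realDivisor e γ
  set a : Fin (n + k) → ℝ := fun i => Real.cos (2 * π * c i) / z with ha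
  have ha0 : ∀ i, 0 < a i := fun i => div_pos (hcos i) hz
  set w : (Fin k → ℝ) → Fin (n + k) → ℝ := fun h i =>
    (χ.origin i).re + ∑ b, h b * χ.normal b i with hw
  refine ⟨fun h => Real.exp (-∑ b, γ b * ((t b).re + h b)) *
    (∏ i, Real.exp (2 * α i ^ 2 / a i) * Real.exp (α i * |w h i|)) * χ.density, α,
    by fun_prop, hγ, fun s h => ?_⟩
  have hsum : ∑ i, α i * χ.realPoint (s, h) i = ∑ b, γ b * ((t b).re + h b) := by
    simp only [α, realDivisor_apply, Finset.sum_mul]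
    rw [Finset.sum_comm]
    refine Finset.sum_congr rfl fun b _ => ?_
    rw [← χ.sum_charge_mul_realPoint b (s, h), Finset.mul_sum]
    exact Finset.sum_congr rfl fun i _ => by ring
  rw [fibreIntegrand, norm_mul, norm_exp_neg_W_div, Complex.norm_real,
    Real.norm_of_nonneg χ.density_pos.le, mul_right_comm]
  refine mul_le_mul_of_nonneg_right ?_ χ.density_pos.le
  have hsplit : ∏ i, Real.exp (-(a i) * Real.exp (χ.realPoint (s, h) i)) =
      Real.exp (-∑ b, γ b * ((t b).re + h b)) * ∏ i, Real.exp (-(a i) *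
        Real.exp (χ.realPoint (s, h) i) + α i * χ.realPoint (s, h) i) := by
    rw [← Real.exp_sum, ← Real.exp_sum, ← Real.exp_add, Finset.sum_add_distrib, hsum]
    congr 1
    ring
  rw [hsplit, mul_assoc, ← Finset.prod_mul_distrib]
  refine mul_le_mul_of_nonneg_left (Finset.prod_le_prod (fun i _ => (Real.exp_pos _).le)
    fun i _ => ?_) (Real.exp_pos _).le
  refine (exp_neg_mul_exp_add_le (ha0 i) (hγ i) _).trans ?_
  rw [mul_assoc]
  refine mul_le_mul_of_nonneg_left ?_ (Real.exp_pos _).le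
  rw [← Real.exp_add, Real.exp_le_exp]
  have hy : χ.realPoint (s, h) i = χ.linearPart s i + w h i := by
    simp only [realPoint, linearPart_apply, hw]
    ring
  have h1 : |χ.linearPart s i| ≤ |χ.realPoint (s, h) i| + |w h i| := by
    have := abs_sub (χ.realPoint (s, h) i) (w h i)
    rwa [hy, add_sub_cancel_right, ← hy] at this
  have h2 := mul_le_mul_of_nonneg_left h1 (hγ i).le
  change α i * _ ≤ α i * _ at h2
  change -α i * _ ≤ _
  linarith

lemma integrable_fibreIntegrand (χ : Chart e (slice e c t)) {z : ℝ} (hz : 0 < z)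
    (hcos : ∀ i, 0 < Real.cos (2 * π * c i)) (h : Fin k → ℝ) :
    Integrable (fun s => χ.fibreIntegrand z (s, h)) := by
  obtain ⟨B, α, -, hα, hle⟩ := χ.exists_norm_fibreIntegrand_le hz hcos
  exact ((integrable_prod_exp_neg_mul_abs χ.linearPart χ.linearPart_injective hα).const_mul
    (B h)).mono' ((χ.continuous_fibreIntegrand z).comp (by fun_prop)).aestronglyMeasurable
    (.of_forall fun s => hle s h)

lemma continuousAt_integral_fibreIntegrand (χ : Chart e (slice e c t)) {z : ℝ} (hz : 0 < z)
    (hcos : ∀ i, 0 < Real.cos (2 * π * c i)) :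
    ContinuousAt (fun h => ∫ s, χ.fibreIntegrand z (s, h)) 0 := by
  obtain ⟨B, α, hB, hα, hle⟩ := χ.exists_norm_fibreIntegrand_le hz hcos
  -- Near `0` the bound `B h` is replaced by a constant, giving a dominating function independent of
  -- `h`.
  have hnear : ∀ᶠ h in nhds (0 : Fin k → ℝ), B h < B 0 + 1 :=
    hB.continuousAt.eventually_lt continuousAt_const (by linarith)
  refine continuousAt_of_dominated (bound := fun s => (B 0 + 1) *
      ∏ i, Real.exp (-α i * |χ.linearPart s i|))
    (.of_forall fun h => ((χ.continuous_fibreIntegrand z).comp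
      (by fun_prop)).aestronglyMeasurable)
    (hnear.mono fun h hh => .of_forall fun s => (hle s h).trans
      (mul_le_mul_of_nonneg_right hh.le (Finset.prod_nonneg fun i _ => (Real.exp_pos _).le)))
    ((integrable_prod_exp_neg_mul_abs χ.linearPart χ.linearPart_injective hα).const_mul _)
    (.of_forall fun s => ((χ.continuous_fibreIntegrand z).comp (by fun_prop)).continuousAt)

lemma equivIntegrand_realPoint (χ : Chart e (slice e c t))
    (ht : ∀ a, (t a).im = 2 * π * ∑ i, (charge e a i : ℝ) * c i) {z : ℝ} (hz : 0 < z)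
    (u : Fin k → ℂ) (p : (Fin n → ℝ) × (Fin k → ℝ)) :
    equivIntegrand e z c (fun a => z * u a) (χ.realPoint p) * χ.density =
      Complex.exp (∑ a, u a * t a) * (Complex.exp (∑ a, u a * p.2 a) * χ.fibreIntegrand z p) := by
  have hH : ∀ a, Htilde e a (cyclePoint c (χ.realPoint p)) = t a + p.2 a := fun a => by
    apply Complex.ext
    · simpa [Htilde, Complex.re_sum, cyclePoint] using χ.sum_charge_mul_realPoint a p
    · rw [Complex.add_im, ht a, Finset.mul_sum]
      simp only [Htilde, Complex.im_sum, Complex.ofReal_im, add_zero]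
      refine Finset.sum_congr rfl fun i _ => ?_
      simp [cyclePoint]
      ring
  rw [equivIntegrand, fibreIntegrand, ← mul_assoc, ← mul_assoc, ← Complex.exp_add,
    ← Complex.exp_add, WG]
  congr 2
  simp only [hH, mul_assoc, ← Finset.mul_sum]
  have hz' : (z : ℂ) ≠ 0 := Complex.ofReal_ne_zero.2 hz.ne'
  rw [← Finset.sum_add_distrib]
  simp only [← mul_add]
  field_simp
  ring

lemma fourierIntegrand_eq_integral (χ : Chart e (slice e c t))
    (ht : ∀ a, (t a).im = 2 * π * ∑ i, (charge e a i : ℝ) * c i) {z : ℝ} (hz : 0 < z)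
    {c₀ : Fin (n + k) → ℝ} {m : Fin (n + k) → ℤ} (hc₀ : ∀ i, |c₀ i - m i| < 1 / 4)
    (hc : ∀ i, |c i - m i| < 1 / 4) {γ : Fin k → ℝ} (hγ : γ ∈ positiveCone e) (ν : Fin k → ℝ) :
    Integrable (fun p : (Fin n → ℝ) × (Fin k → ℝ) =>
      Complex.exp (∑ a, tubePoint γ ν a * p.2 a) * χ.fibreIntegrand z p) ∧
    fourierIntegrand (fun u => equivCentralCharge e z c₀ (fun a => z * u a)) t γ ν =
      ∫ h : Fin k → ℝ, Complex.exp (∑ a, tubePoint γ ν a * h a) *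
        ∫ s, χ.fibreIntegrand z (s, h) := by
  set u := tubePoint γ ν with hu
  have hmem : (fun a => (u a).re) ∈ positiveCone e := by
    rw [hu, tubePoint_re]
    exact hγ
  have hint : Integrable (equivIntegrand e z c fun a => z * u a) :=
    (integrable_equivIntegrand_iff e hz hc _).2 (divisor_smul_re_pos hz hmem)
  have hcancel : ∀ p : (Fin n → ℝ) × (Fin k → ℝ),
      Complex.exp (∑ a, u a * p.2 a) * χ.fibreIntegrand z p =
      Complex.exp (-∑ a, u a * t a) *
        (equivIntegrand e z c (fun a => z * u a) (χ.realPoint p) * χ.density) := fun p => by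
    rw [χ.equivIntegrand_realPoint ht hz, ← mul_assoc (Complex.exp (-_)), ← Complex.exp_add,
      neg_add_cancel, Complex.exp_zero, one_mul]
  have hprod : Integrable (fun p : (Fin n → ℝ) × (Fin k → ℝ) =>
      Complex.exp (∑ a, u a * p.2 a) * χ.fibreIntegrand z p) := by
    rw [funext hcancel]
    exact ((χ.integrable_comp_realPoint hint).mul_const _).const_mul _
  refine ⟨hprod, ?_⟩
  -- The central charge sees the cycle only through `m`, so the cycle may be moved to the one
  -- containing the slice.
  have hZ : equivCentralCharge e z c₀ (fun a => z * u a) =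
      equivCentralCharge e z c (fun a => z * u a) := by
    rw [equivCentralCharge_smul_eq e hz hc₀ hmem, equivCentralCharge_smul_eq e hz hc hmem]
  rw [fourierIntegrand, ← hu, hZ, equivCentralCharge, χ.integral_eq_integral_realPoint hint,
    mul_comm, ← integral_const_mul, ← funext hcancel]
  simp only [← integral_const_mul]
  exact integral_prod_symm _ hprod

end Chart

/-- The inverse Fourier transform of the equivariant central charge is the fibre integral. -/
lemma hasInverseFourier_equivCentralCharge (e : Module.Basis (Fin k) ℤ S.L) {z : ℝ} (hz : 0 < z)
    {c c' : Fin (n + k) → ℝ} {m : Fin (n + k) → ℤ} (hc : ∀ i, |c i - m i| < 1 / 4)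
    (hc' : ∀ i, |c' i - m i| < 1 / 4) {t : Fin k → ℂ}
    (ht : ∀ a, (t a).im = 2 * π * ∑ i, (charge e a i : ℝ) * c' i)
    (χ : Chart e (slice e c' t)) :
    HasInverseFourier (positiveCone e)
      (fun u => equivCentralCharge e z c (fun a => z * u a)) t (χ.centralCharge z) := by
  have hhol := differentiableOn_equivCentralCharge e hz hc
  obtain ⟨A, ε, hA, hε, hle⟩ := exists_norm_fourierIntegrand_le e hz hc hc' ht
  have hdecay := integrable_prod_exp_neg_mul_abs (realDivisor e) (realDivisor_injective e) hε
  have hintegrable : ∀ γ ∈ positiveCone e, Integrable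
      (fourierIntegrand (fun u => equivCentralCharge e z c (fun a => z * u a)) t γ) :=
    fun γ hγ => (hdecay.const_mul (A γ)).mono' (continuous_fourierIntegrand
      hhol t hγ).aestronglyMeasurable (.of_forall (hle γ hγ))
  refine ⟨isOpen_positiveCone e, positiveCone_nonempty e, hhol, hintegrable, fun K hK hKc => ?_,
    fun γ hγ => ?_⟩
  · obtain ⟨C, hC⟩ := hKc.exists_bound_of_continuousOn (hA.mono hK)
    refine ⟨_, hdecay.const_mul C, fun γ hγ ν => (hle γ (hK hγ) ν).trans ?_⟩
    exact mul_le_mul_of_nonneg_right ((le_abs_self _).trans (hC γ hγ))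
      (Finset.prod_nonneg fun i _ => (Real.exp_pos _).le)
  · have hcos : ∀ i, 0 < Real.cos (2 * π * c' i) := fun i => cos_angle_pos (hc' i)
    -- The tilt by `exp(γ·h)` makes the fibre integral integrable in `h`; it equals `1` at `h = 0`,
    -- so the inverted value does not depend on `γ`.
    set g : (Fin k → ℝ) → ℂ := fun h =>
      Complex.exp ((∑ a, γ a * h a : ℝ) : ℂ) * ∫ s, χ.fibreIntegrand z (s, h) with hg
    -- Fubini at the real point `u = γ` of the tube, that is `ν = 0`.
    have hgint : Integrable g := by
      have h := (χ.fourierIntegrand_eq_integral ht hz hc hc' hγ 0).1.integral_prod_right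
      simpa [integral_const_mul, tubePoint, hg] using h
    have hgcont : ContinuousAt g 0 :=
      ContinuousAt.mul (Continuous.continuousAt (by fun_prop))
        (χ.continuousAt_integral_fibreIntegrand hz hcos)
    have hF : ∀ ν, fourierIntegrand (fun u => equivCentralCharge e z c (fun a => z * u a)) t γ ν =
        ∫ h, Complex.exp ((∑ a, ν a * h a : ℝ) * Complex.I) * g h := fun ν => by
      rw [(χ.fourierIntegrand_eq_integral ht hz hc hc' hγ ν).2]
      congr 1 with h
      rw [hg]
      simp only
      rw [← mul_assoc, ← Complex.exp_add]
      congr 2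
      push_cast
      rw [Finset.sum_mul, ← Finset.sum_add_distrib]
      refine Finset.sum_congr rfl fun a _ => ?_
      simp only [tubePoint]
      ring
    have hFint := hintegrable γ hγ
    rw [funext hF] at hFint ⊢
    rw [integral_integral_exp_mul_eq hgint hgcont hFint]
    simp [hg, Chart.centralCharge, χ.integrand_eq_fibreIntegrand]

end ToricMirror

end

open ToricMirror in
theorem proposition4p1 {n k : ℕ} (S : StackyFan n k) (e : Module.Basis (Fin k) ℤ S.L)
    (z : ℝ) (hz : 0 < z)
    (c : Fin (n + k) → ℝ) (m : Fin (n + k) → ℤ) (hc : ∀ i, |c i - m i| < 1 / 4) :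
    -- absolute convergence of the equivariant central charge
    (∀ lam : Fin k → ℂ,
      MeasureTheory.Integrable (equivIntegrand e z c lam) ↔ ∀ i, 0 < (divisor e i lam).re) ∧
    -- its value
    (∀ lam : Fin k → ℂ, (∀ i, 0 < (divisor e i lam).re) →
      equivCentralCharge e z c lam =
        (∏ i, Complex.exp (2 * Real.pi * Complex.I * m i * divisor e i lam / z)) *
          ∏ i, ((z : ℂ) ^ (divisor e i lam / z) * Complex.Gamma (divisor e i lam / z)) ∧
      equivCentralCharge e z c lam =
        (z : ℂ) ^ (n + k) *
          (∏ i, Complex.exp (2 * Real.pi * Complex.I * m i * divisor e i lam / z)) *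
          ∏ i, ((z : ℂ) ^ (divisor e i lam / z) *
            (Complex.Gamma (1 + divisor e i lam / z) / divisor e i lam))) ∧
    -- its inverse Fourier transform in `u = lam / z`
    (∀ (c' : Fin (n + k) → ℝ), (∀ i, |c' i - m i| < 1 / 4) →
      ∀ t : Fin k → ℂ, (∀ a, (t a).im = 2 * Real.pi * ∑ i, (charge e a i : ℝ) * c' i) →
        slice e c' t ⊆ mirrorFibre e t ∧
        Nonempty (Chart e (slice e c' t)) ∧
        ∀ χ : Chart e (slice e c' t),
          MeasureTheory.Integrable (χ.integrand z) ∧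
          HasInverseFourier (positiveCone e)
            (fun u => equivCentralCharge e z c (fun a => z * u a)) t (χ.centralCharge z)) := by
  refine ⟨integrable_equivIntegrand_iff e hz hc, fun lam hlam =>
    ⟨equivCentralCharge_eq_prod_Gamma e hz hc hlam,
      equivCentralCharge_eq_prod_Gamma_one_add e hz hc hlam⟩, fun c' hc' t ht =>
    ⟨slice_subset_mirrorFibre e ht, nonempty_chart e c' t, fun χ => ⟨?_,
      hasInverseFourier_equivCentralCharge e hz hc hc' ht χ⟩⟩⟩
  rw [funext (χ.integrand_eq_fibreIntegrand z)]
  exact χ.integrable_fibreIntegrand hz (fun i => cos_angle_pos (hc' i)) 0
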